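/- \textbf{Definitions.} Let $\omega$ denote the exponent of matrix multiplication over $\mathbb{C}$: the smallest real number such that for each $\varepsilon>0$ two complex $n\times n$ matrices can be multiplied with $O(n^{\omega+\varepsilon})$ field operations. Here an algorithm for a given $n$ is a straight-line program over $\mathbb{C}$ that starts from the entries of the two matrices and arbitrary complex constants, uses the operations $+,-,\times,/$ (each counted once), and is correct, without division by zero, on every input. A finite group $G$ \emph{realizes} $\langle n,m,p\rangle$ if there are subsets $S_1,S_2,S_3\subseteq G$ with $|S_1|=n$, $|S_2|=m$, $|S_3|=p$ such that, for all $q_i\in Q(S_i)=\{st^{-1}: s,t\in S_i\}$, $q_1q_2q_3=1$ implies $q_1=q_2=q_3=1$. The \emph{pseudo-exponent} $\alpha(G)$ of a non-trivial finite group $G$ is the minimum of $$\frac{3\log|G|}{\log (nmp)}$$ over all positive integers $n,m,p$, not all equal to $1$, such that $G$ realizes $\langle n,m,p\rangle$; the pseudo-exponent of the trivial group is $3$. Let $d_{\max}(G)$ be the maximum dimension of an irreducible complex representation of $G$. For non-abelian $G$ define $\gamma(G)$ by $|G|^{1/\gamma(G)}=d_{\max}(G)$, and put $\gamma(G)=\infty$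 if $G$ is abelian. \textbf{Statement.} Suppose there exists a family $G_1,G_2,\dots$ of finite groups such that $\alpha(G_i)=2+o(1)$ as $i\to\infty$, and furthermore $\alpha(G_i)-2=o(\gamma(G_i)-2)$, that is, for every $c>0$ one has $|\alpha(G_i)-2|\le c\,(\gamma(G_i)-2)$ for all sufficiently large $i$ (a condition that holds trivially for those $i$ with $\gamma(G_i)=\infty$). Then the exponent of matrix multiplication is $\omega=2$. -/

import Mathlib

/-! ### Straight-line computations over `ℂ` and the exponent of matrix multiplication -/

/-- `f` arises from the functions in `S` by one field operation `+`, `-`, `*`, `/`, carried out on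
every input; a division is admissible only when the divisor vanishes at no input. -/
inductive ArithStep {X : Type*} (S : Set (X → ℂ)) : (X → ℂ) → Prop
  | add {f g : X → ℂ} : f ∈ S → g ∈ S → ArithStep S (fun x => f x + g x)
  | sub {f g : X → ℂ} : f ∈ S → g ∈ S → ArithStep S (fun x => f x - g x)
  | mul {f g : X → ℂ} : f ∈ S → g ∈ S → ArithStep S (fun x => f x * g x)
  | div {f g : X → ℂ} : f ∈ S → g ∈ S → (∀ x, g x ≠ 0) → ArithStep S (fun x => f x / g x)

/-- What is at hand, free of charge, after the intermediate results `L` have been computed: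
the inputs, the complex constants, and the results in `L`. -/
def availableValues {X : Type*} (inputs : Set (X → ℂ)) (L : List (X → ℂ)) : Set (X → ℂ) :=
  inputs ∪ Set.range (fun c : ℂ => fun _ : X => c) ∪ {f | f ∈ L}

/-- `L` lists the results, the latest one first, of the operations of a straight-line program on
the given inputs. Each entry of `L` costs one operation. -/
inductive IsComputation {X : Type*} (inputs : Set (X → ℂ)) : List (X → ℂ) → Prop
  | nil : IsComputation inputs []
  | cons {f : X → ℂ} {L : List (X → ℂ)} : IsComputation inputs L →
      ArithStep (availableValues inputs L) f → IsComputation inputs (f :: L)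

/-- The `2 n ^ 2` input functions of `n × n` matrix multiplication: the entries of the two
factors. -/
def matMulInputs (n : ℕ) :
    Set (Matrix (Fin n) (Fin n) ℂ × Matrix (Fin n) (Fin n) ℂ → ℂ) :=
  {f | ∃ i j : Fin n, (f = fun P => P.1 i j) ∨ (f = fun P => P.2 i j)}

/-- Two complex `n × n` matrices can be multiplied with at most `k` field operations. -/
def MatMulWithin (n k : ℕ) : Prop :=
  ∃ L : List (Matrix (Fin n) (Fin n) ℂ × Matrix (Fin n) (Fin n) ℂ → ℂ),
    IsComputation (matMulInputs n) L ∧ L.length ≤ k ∧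
      ∀ i j : Fin n, (fun P => (P.1 * P.2) i j) ∈ availableValues (matMulInputs n) L

/-- The exponent of matrix multiplication over `ℂ`: the smallest `w` such that, for each `ε > 0`,
`n × n` matrices can be multiplied with `O(n ^ (w + ε))` field operations. -/
noncomputable def matMulExponent : ℝ :=
  sInf {w : ℝ | ∀ ε : ℝ, 0 < ε → ∃ C : ℝ, ∀ n : ℕ, 1 ≤ n →
    ∃ k : ℕ, MatMulWithin n k ∧ (k : ℝ) ≤ C * (n : ℝ) ^ (w + ε)}

/-! ### The triple product property and the pseudo-exponent -/

/-- The right quotient set of a subset of a group. -/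
def rightQuotientSet {G : Type*} [Group G] (S : Finset G) : Set G :=
  {q | ∃ s ∈ S, ∃ t ∈ S, q = s * t⁻¹}

/-- The triple product property of three subsets of a group. -/
def TripleProductProperty {G : Type*} [Group G] (S T U : Finset G) : Prop :=
  ∀ a ∈ rightQuotientSet S, ∀ b ∈ rightQuotientSet T, ∀ c ∈ rightQuotientSet U,
    a * b * c = 1 → a = 1 ∧ b = 1 ∧ c = 1

/-- The group `G` realizes `⟨n, m, p⟩`. -/
def Realizes (G : Type*) [Group G] (n m p : ℕ) : Prop :=
  ∃ S T U : Finset G, S.card = n ∧ T.card = m ∧ U.card = p ∧ TripleProductProperty S T U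

open scoped Classical in
/-- The pseudo-exponent of a finite group. The sizes `n, m, p` are positive: empty subsets would
satisfy the triple product property vacuously. -/
noncomputable def pseudoExponent (G : Type*) [Group G] : ℝ :=
  if Nontrivial G then
    sInf {x : ℝ | ∃ n m p : ℕ, 0 < n ∧ 0 < m ∧ 0 < p ∧ ¬ (n = 1 ∧ m = 1 ∧ p = 1) ∧
      Realizes G n m p ∧
      x = 3 * Real.log (Nat.card G) / Real.log ((n : ℝ) * (m : ℝ) * (p : ℝ))}
  else 3

/-! ### Character degrees -/

/-- `d` is a character degree of `G`: the dimension of an irreducible complex representation. -/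
def IsCharacterDegree (G : Type*) [Group G] (d : ℕ) : Prop :=
  ∃ ρ : Representation ℂ G (Fin d → ℂ), ρ.IsIrreducible

/-- The maximum character degree of a finite group. -/
noncomputable def maxCharacterDegree (G : Type*) [Group G] : ℕ :=
  sSup {d : ℕ | IsCharacterDegree G d}

open scoped Classical in
/-- The number `γ` for which `|G| ^ (1 / γ)` is the maximum character degree `d` of `G`, that is,
`γ = log |G| / log d`; it is infinite when `G` is abelian. -/
noncomputable def degreeExponent (G : Type*) [Group G] : EReal :=
  if ∀ a b : G, a * b = b * a then ⊤
  else ((Real.log (Nat.card G) / Real.log (maxCharacterDegree G) : ℝ) : EReal)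

/-! This is the Cohn–Umans argument. The triple product property makes the tensor of ⟨n,m,p⟩ a
restriction of the multiplication tensor of ℂ[G] (`TripleProductProperty.matMulTensor_eq`), and by
Wedderburn ℂ[G] is a product of matrix algebras of sizes d_i with ∑ d_i² = |G|
(`exists_groupTensor_decomposition`). Hence (nmp)^(ω/3) ≤ ∑ d_i^ω ≤ d_max^(ω-2) |G|. At a triple
attaining α, and with |G| = d_max^γ, this rearranges to (ω-2)(γ-2) ≤ (α-2)(ω-2+γ). If ω > 2, then α
→ 2 and α-2 = o(γ-2) make the right side at most half of the left, which is positive: a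
contradiction.

The inequality for ω needs operation counts and tensor rank to have the same exponent. From programs
to rank, Strassen's removal of divisions keeps only second-order Taylor parts
(`IsComputation.exists_quadraticExpansion`, `MatMulWithin.tensorRankLE`). From rank to programs, a
bilinear algorithm is applied recursively to blocks (`exists_matMulWithin_of_tensorRankLE`). Tensor
powers (`TripleProductProperty.tensorRankLE`) make the constant hidden in O(n^w) negligible. -/

/-! ### Straight-line computations -/

section Computation

variable {X : Type*}

/-- The functions in `F` can be computed from `inputs` with at most `k` field operations. -/
def ComputesWithin (inputs F : Set (X → ℂ)) (k : ℕ) : Prop :=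
  ∃ L : List (X → ℂ), IsComputation inputs L ∧ L.length ≤ k ∧ F ⊆ availableValues inputs L

theorem input_mem_availableValues {inputs : Set (X → ℂ)} {f : X → ℂ} (L : List (X → ℂ))
    (hf : f ∈ inputs) : f ∈ availableValues inputs L := Or.inl (Or.inl hf)

theorem const_mem_availableValues (inputs : Set (X → ℂ)) (L : List (X → ℂ)) (c : ℂ) :
    (fun _ => c) ∈ availableValues inputs L := Or.inl (Or.inr ⟨c, rfl⟩)

theorem list_mem_availableValues {inputs : Set (X → ℂ)} {f : X → ℂ} {L : List (X → ℂ)}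
    (hf : f ∈ L) : f ∈ availableValues inputs L := Or.inr hf

theorem ArithStep.mono {S T : Set (X → ℂ)} (h : S ⊆ T) {f : X → ℂ} (hf : ArithStep S f) :
    ArithStep T f := by
  cases hf with
  | add h₁ h₂ => exact .add (h h₁) (h h₂)
  | sub h₁ h₂ => exact .sub (h h₁) (h h₂)
  | mul h₁ h₂ => exact .mul (h h₁) (h h₂)
  | div h₁ h₂ h₃ => exact .div (h h₁) (h h₂) h₃

theorem availableValues_append_subset {inputs inputs' : Set (X → ℂ)} {L : List (X → ℂ)}
    (h : inputs' ⊆ availableValues inputs L) (L' : List (X → ℂ)) :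
    availableValues inputs' L' ⊆ availableValues inputs (L' ++ L) := by
  rintro f ((hf | ⟨c, rfl⟩) | hf)
  · rcases h hf with (hf | hf) | hf
    · exact Or.inl (Or.inl hf)
    · exact Or.inl (Or.inr hf)
    · exact Or.inr (List.mem_append_right _ hf)
  · exact const_mem_availableValues _ _ c
  · exact Or.inr (List.mem_append_left _ hf)

theorem IsComputation.append {inputs inputs' : Set (X → ℂ)} {L L' : List (X → ℂ)}
    (hL : IsComputation inputs L) (h : inputs' ⊆ availableValues inputs L)
    (hL' : IsComputation inputs' L') : IsComputation inputs (L' ++ L) := by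
  induction hL' with
  | nil => exact hL
  | cons _ hf ih => exact .cons ih (hf.mono (availableValues_append_subset h _))

theorem ComputesWithin.of_subset {inputs F : Set (X → ℂ)} (h : F ⊆ inputs) :
    ComputesWithin inputs F 0 :=
  ⟨[], .nil, le_rfl, fun _ hf => input_mem_availableValues _ (h hf)⟩

theorem ComputesWithin.mono {inputs F F' : Set (X → ℂ)} {k k' : ℕ}
    (h : ComputesWithin inputs F k) (hF : F' ⊆ F) (hk : k ≤ k') :
    ComputesWithin inputs F' k' := by
  obtain ⟨L, hL, hlen, hsub⟩ := h
  exact ⟨L, hL, hlen.trans hk, hF.trans hsub⟩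

theorem ComputesWithin.trans {inputs F H : Set (X → ℂ)} {k l : ℕ}
    (h₁ : ComputesWithin inputs F k) (h₂ : ComputesWithin F H l) :
    ComputesWithin inputs H (k + l) := by
  obtain ⟨L, hL, hlen, hsub⟩ := h₁
  obtain ⟨L', hL', hlen', hsub'⟩ := h₂
  refine ⟨L' ++ L, hL.append hsub hL', ?_, hsub'.trans (availableValues_append_subset hsub _)⟩
  rw [List.length_append]
  omega

theorem ComputesWithin.inputs_mono {inputs inputs' F : Set (X → ℂ)} {k : ℕ}
    (h : ComputesWithin inputs F k) (hi : inputs ⊆ inputs') : ComputesWithin inputs' F k := by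
  simpa using (ComputesWithin.of_subset hi).trans h

theorem ComputesWithin.union {inputs F H : Set (X → ℂ)} {k l : ℕ}
    (h₁ : ComputesWithin inputs F k) (h₂ : ComputesWithin inputs H l) :
    ComputesWithin inputs (F ∪ H) (k + l) := by
  obtain ⟨L, hL, hlen, hsub⟩ := h₁
  obtain ⟨L', hL', hlen', hsub'⟩ := h₂
  have hi : inputs ⊆ availableValues inputs L := fun f hf => input_mem_availableValues _ hf
  refine ⟨L' ++ L, hL.append hi hL', ?_, Set.union_subset ?_ ?_⟩
  · rw [List.length_append]
    omega
  · intro f hf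
    rcases hsub hf with hf | hf
    · exact Or.inl hf
    · exact Or.inr (List.mem_append_right _ hf)
  · exact hsub'.trans (availableValues_append_subset hi _)

theorem ComputesWithin.biUnion {ι : Type*} {inputs : Set (X → ℂ)} {F : ι → Set (X → ℂ)}
    {k : ι → ℕ} (s : Finset ι) (h : ∀ i ∈ s, ComputesWithin inputs (F i) (k i)) :
    ComputesWithin inputs (⋃ i ∈ s, F i) (∑ i ∈ s, k i) := by
  classical
  induction s using Finset.induction_on with
  | empty => simpa using ComputesWithin.of_subset (Set.empty_subset inputs)
  | insert a s ha ih =>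
    rw [Finset.sum_insert ha, Finset.set_biUnion_insert]
    exact (h a (Finset.mem_insert_self a s)).union
      (ih fun i hi => h i (Finset.mem_insert_of_mem hi))

theorem ComputesWithin.iUnion {ι : Type*} [Fintype ι] {inputs : Set (X → ℂ)}
    {F : ι → Set (X → ℂ)} {k : ℕ} (h : ∀ i, ComputesWithin inputs (F i) k) :
    ComputesWithin inputs (⋃ i, F i) (Fintype.card ι * k) := by
  simpa using ComputesWithin.biUnion Finset.univ fun i _ => h i

theorem ComputesWithin.of_arithStep {inputs : Set (X → ℂ)} {f : X → ℂ}
    (h : ArithStep (availableValues inputs []) f) : ComputesWithin inputs {f} 1 :=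
  ⟨[f], .cons .nil h, le_rfl, by
    rintro _ rfl
    exact list_mem_availableValues (by simp)⟩

/-- Each term costs one scaling and one addition; the empty sum is the free constant 0. -/
theorem ComputesWithin.linearCombination {ι : Type*} {inputs : Set (X → ℂ)} (s : Finset ι)
    (c : ι → ℂ) (f : ι → X → ℂ) (hf : ∀ i ∈ s, f i ∈ inputs) :
    ComputesWithin inputs {fun x => ∑ i ∈ s, c i * f i x} (2 * s.card) := by
  classical
  induction s using Finset.induction_on with
  | empty =>
    refine ⟨[], .nil, le_rfl, ?_⟩
    rintro _ rfl
    simpa using const_mem_availableValues inputs [] 0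
  | insert a s ha ih =>
    have h₁ := ih fun i hi => hf i (Finset.mem_insert_of_mem hi)
    have h₂ : ComputesWithin inputs {fun x => c a * f a x} 1 :=
      .of_arithStep (.mul (const_mem_availableValues _ _ (c a))
        (input_mem_availableValues _ (hf a (Finset.mem_insert_self a s))))
    refine ((h₂.union h₁).trans (.of_arithStep (.add (f := fun x => c a * f a x)
      (g := fun x => ∑ i ∈ s, c i * f i x) ?_ ?_))).mono ?_ ?_
    · exact input_mem_availableValues _ (Or.inl rfl)
    · exact input_mem_availableValues _ (Or.inr rfl)
    · rintro _ rfl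
      simp only [Set.mem_singleton_iff]
      funext x
      rw [Finset.sum_insert ha]
    · rw [Finset.card_insert_of_notMem ha]
      omega

end Computation

/-! ### Quadratic parts of straight-line computations -/

section Jet

variable {E : Type*} [AddCommGroup E] [Module ℂ E]

/-- Along each line through the origin, `f` has the second-order expansion with constant term `c`,
linear term `l` and quadratic term `q`. -/
def HasQuadraticExpansion (f : E → ℂ) (c : ℂ) (l : E →ₗ[ℂ] ℂ) (q : E → ℂ) : Prop :=
  ∀ x, ∃ r : ℂ → ℂ, ContinuousAt r 0 ∧ r 0 = q x ∧ ∀ t, f (t • x) = c + t * l x + t ^ 2 * r t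

namespace HasQuadraticExpansion

variable {f g : E → ℂ} {c d : ℂ} {l m : E →ₗ[ℂ] ℂ} {q s : E → ℂ}

theorem const (c : ℂ) : HasQuadraticExpansion (fun _ : E => c) c 0 0 := fun _ =>
  ⟨0, continuousAt_const, rfl, fun t => by simp⟩

theorem linear (l : E →ₗ[ℂ] ℂ) : HasQuadraticExpansion l 0 l 0 := fun _ =>
  ⟨0, continuousAt_const, rfl, fun t => by simp⟩

theorem add (hf : HasQuadraticExpansion f c l q) (hg : HasQuadraticExpansion g d m s) :
    HasQuadraticExpansion (fun x => f x + g x) (c + d) (l + m) (q + s) := by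
  intro x
  obtain ⟨r, hr, hr0, hrt⟩ := hf x
  obtain ⟨u, hu, hu0, hut⟩ := hg x
  refine ⟨fun t => r t + u t, hr.add hu, by simp [hr0, hu0], fun t => ?_⟩
  simp only [hrt, hut, LinearMap.add_apply]
  ring

theorem sub (hf : HasQuadraticExpansion f c l q) (hg : HasQuadraticExpansion g d m s) :
    HasQuadraticExpansion (fun x => f x - g x) (c - d) (l - m) (q - s) := by
  intro x
  obtain ⟨r, hr, hr0, hrt⟩ := hf x
  obtain ⟨u, hu, hu0, hut⟩ := hg x
  refine ⟨fun t => r t - u t, hr.sub hu, by simp [hr0, hu0], fun t => ?_⟩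
  simp only [hrt, hut, LinearMap.sub_apply]
  ring

theorem mul (hf : HasQuadraticExpansion f c l q) (hg : HasQuadraticExpansion g d m s) :
    HasQuadraticExpansion (fun x => f x * g x) (c * d) (c • m + d • l)
      (c • s + d • q + fun x => l x * m x) := by
  intro x
  obtain ⟨r, hr, hr0, hrt⟩ := hf x
  obtain ⟨u, hu, hu0, hut⟩ := hg x
  refine ⟨fun t => c * u t + d * r t + l x * m x + t * (l x * u t + m x * r t) +
      t ^ 2 * (r t * u t),
    by fun_prop, by simp [hr0, hu0], fun t => ?_⟩
  beta_reduce
  rw [hrt, hut]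
  simp only [LinearMap.add_apply, LinearMap.smul_apply, smul_eq_mul]
  ring

theorem apply_zero (hf : HasQuadraticExpansion f c l q) : f 0 = c := by
  obtain ⟨r, -, -, hrt⟩ := hf 0
  simpa using hrt 0

/-- Expand f = (f/g)·g to second order and solve for the quotient, using d = g(0) ≠ 0. As for a
product, the only new quadratic term is one product of two linear forms. -/
theorem div (hf : HasQuadraticExpansion f c l q) (hg : HasQuadraticExpansion g d m s)
    (h0 : ∀ x, g x ≠ 0) :
    HasQuadraticExpansion (fun x => f x / g x) (c / d) (d⁻¹ • (l - (c / d) • m))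
      (d⁻¹ • (q - (c / d) • s - fun x => (d⁻¹ • (l - (c / d) • m)) x * m x)) := by
  intro x
  have hd : d ≠ 0 := hg.apply_zero ▸ h0 0
  obtain ⟨r, hr, hr0, hrt⟩ := hf x
  obtain ⟨u, hu, hu0, hut⟩ := hg x
  set k := d⁻¹ • (l - (c / d) • m) with hk
  have hkx : k x = (l x - c / d * m x) / d := by
    simp [hk, div_eq_inv_mul]
  have hgc : ContinuousAt (fun t : ℂ => g (t • x)) 0 := by
    simp only [hut]
    fun_prop
  refine ⟨fun t => (r t - c / d * u t - k x * m x - t * k x * u t) / g (t • x),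
    ContinuousAt.div (by fun_prop) hgc (h0 _), ?_, fun t => ?_⟩
  · simp only [zero_smul, hg.apply_zero, Pi.smul_apply, Pi.sub_apply, smul_eq_mul, hr0, hu0]
    rw [div_eq_inv_mul]
    ring
  · have hgt := h0 (t • x)
    have hl : l x = d * k x + c / d * m x := by
      rw [hkx]
      field_simp
      ring
    have hc : c = c / d * d := by field_simp
    have h1 := hrt t
    have h2 := hut t
    rw [div_eq_iff hgt, add_mul, mul_div_assoc', div_mul_cancel₀ _ hgt, h1, h2, hl]
    generalize c / d = z at *
    rw [hc]
    ring

/-- Taking t = 0 kills the constant term; dividing by t, then by t², and letting t → 0 kills the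
linear term and identifies the quadratic one. -/
theorem eq_of_homogeneous (hf : HasQuadraticExpansion f c l q)
    (h : ∀ (t : ℂ) x, f (t • x) = t ^ 2 * f x) : q = f := by
  funext x
  obtain ⟨r, hr, hr0, hrt⟩ := hf x
  have hc : c = 0 := by
    have := hrt 0
    rw [h] at this
    simpa using this.symm
  have hev : ∀ᶠ t : ℂ in nhdsWithin 0 {0}ᶜ, t ≠ 0 := eventually_mem_nhdsWithin
  have hr' : Filter.Tendsto r (nhdsWithin 0 {0}ᶜ) (nhds (q x)) :=
    hr0 ▸ hr.tendsto.mono_left nhdsWithin_le_nhds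
  have ht : Filter.Tendsto (fun t : ℂ => t) (nhdsWithin 0 {0}ᶜ) (nhds 0) :=
    Filter.tendsto_id.mono_left nhdsWithin_le_nhds
  have hlx : l x = 0 := by
    have h1 : Filter.Tendsto (fun t : ℂ => t * (f x - r t)) (nhdsWithin 0 {0}ᶜ) (nhds 0) := by
      simpa using ht.mul (tendsto_const_nhds.sub hr')
    refine tendsto_nhds_unique (tendsto_const_nhds.congr' ?_) h1
    filter_upwards [hev] with t ht0
    have := hrt t
    rw [h, hc] at this
    have : t * l x = t * (t * (f x - r t)) := by linear_combination -this
    exact mul_left_cancel₀ ht0 this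
  refine tendsto_nhds_unique hr' (tendsto_const_nhds.congr' ?_)
  filter_upwards [hev] with t ht0
  have := hrt t
  rw [h, hc, hlx] at this
  have : t ^ 2 * f x = t ^ 2 * r t := by linear_combination this
  exact mul_left_cancel₀ (pow_ne_zero 2 ht0) this

end HasQuadraticExpansion

/-- Each operation enlarges the span of the quadratic parts by at most one product of linear forms,
so their number is bounded by the length of the program, divisions included. -/
theorem IsComputation.exists_quadraticExpansion {inputs : Set (E → ℂ)}
    (hin : ∀ f ∈ inputs, ∃ l : E →ₗ[ℂ] ℂ, f = l) {L : List (E → ℂ)}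
    (hL : IsComputation inputs L) :
    ∃ a b : Fin L.length → E →ₗ[ℂ] ℂ, ∀ f ∈ availableValues inputs L, ∃ c l, ∃ q : E → ℂ,
      HasQuadraticExpansion f c l q ∧
      q ∈ Submodule.span ℂ (Set.range fun t x => a t x * b t x) := by
  induction hL with
  | nil =>
    refine ⟨0, 0, ?_⟩
    rintro f ((hf | ⟨c, rfl⟩) | hf)
    · obtain ⟨l, rfl⟩ := hin f hf
      exact ⟨0, l, 0, .linear l, zero_mem _⟩
    · exact ⟨c, 0, 0, .const c, zero_mem _⟩
    · simp at hf
  | @cons f L _ hf ih =>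
    obtain ⟨a, b, hab⟩ := ih
    obtain ⟨a₀, b₀, c, l, q, hq, hqs⟩ : ∃ a₀ b₀ : E →ₗ[ℂ] ℂ, ∃ c l, ∃ q : E → ℂ,
        HasQuadraticExpansion f c l q ∧
        q ∈ Submodule.span ℂ (insert (fun x => a₀ x * b₀ x)
          (Set.range fun t x => a t x * b t x)) := by
      -- Additions and subtractions need no new product; the slot is filled with 0 · 0.
      have hle : Submodule.span ℂ (Set.range fun t x => a t x * b t x) ≤ Submodule.span ℂ _ :=
        Submodule.span_mono (Set.subset_insert (fun x => (0 : E →ₗ[ℂ] ℂ) x * (0 : E →ₗ[ℂ] ℂ) x) _)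
      cases hf with
      | add h₁ h₂ =>
        obtain ⟨c, l, q, hq, hqs⟩ := hab _ h₁
        obtain ⟨d, m, s, hs, hss⟩ := hab _ h₂
        exact ⟨0, 0, _, _, _, hq.add hs, add_mem (hle hqs) (hle hss)⟩
      | sub h₁ h₂ =>
        obtain ⟨c, l, q, hq, hqs⟩ := hab _ h₁
        obtain ⟨d, m, s, hs, hss⟩ := hab _ h₂
        exact ⟨0, 0, _, _, _, hq.sub hs, sub_mem (hle hqs) (hle hss)⟩
      | mul h₁ h₂ =>
        obtain ⟨c, l, q, hq, hqs⟩ := hab _ h₁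
        obtain ⟨d, m, s, hs, hss⟩ := hab _ h₂
        have hle' := Submodule.span_mono (R := ℂ) (Set.subset_insert (fun x => l x * m x)
          (Set.range fun t x => a t x * b t x))
        exact ⟨l, m, _, _, _, hq.mul hs, add_mem (add_mem (Submodule.smul_mem _ _ (hle' hss))
          (Submodule.smul_mem _ _ (hle' hqs))) (Submodule.subset_span (Set.mem_insert _ _))⟩
      | div h₁ h₂ h₃ =>
        obtain ⟨c, l, q, hq, hqs⟩ := hab _ h₁
        obtain ⟨d, m, s, hs, hss⟩ := hab _ h₂
        have hle' := Submodule.span_mono (R := ℂ) (Set.subset_insert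
          (fun x => (d⁻¹ • (l - (c / d) • m)) x * m x) (Set.range fun t x => a t x * b t x))
        exact ⟨_, m, _, _, _, hq.div hs h₃, Submodule.smul_mem _ _ (sub_mem (sub_mem (hle' hqs)
          (Submodule.smul_mem _ _ (hle' hss))) (Submodule.subset_span (Set.mem_insert _ _)))⟩
    have hrange : (Set.range fun (t : Fin (f :: L).length) x =>
        (Fin.cons a₀ a : Fin (L.length + 1) → E →ₗ[ℂ] ℂ) t x *
          (Fin.cons b₀ b : Fin (L.length + 1) → E →ₗ[ℂ] ℂ) t x) =
        insert (fun x => a₀ x * b₀ x) (Set.range fun t x => a t x * b t x) := by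
      ext g
      simp only [Set.mem_range, Set.mem_insert_iff]
      constructor
      · rintro ⟨t, rfl⟩
        refine Fin.cases (Or.inl ?_) (fun t => Or.inr ⟨t, ?_⟩) t
        · simp
        · simp
      · rintro (rfl | ⟨t, rfl⟩)
        · exact ⟨(0 : Fin (L.length + 1)), by simp⟩
        · exact ⟨(t.succ : Fin (L.length + 1)), by simp⟩
    refine ⟨(Fin.cons a₀ a : Fin (L.length + 1) → E →ₗ[ℂ] ℂ),
      (Fin.cons b₀ b : Fin (L.length + 1) → E →ₗ[ℂ] ℂ), ?_⟩
    rw [hrange]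
    have hold : ∀ g ∈ availableValues inputs L, ∃ c l, ∃ q : E → ℂ,
        HasQuadraticExpansion g c l q ∧ q ∈ Submodule.span ℂ (insert (fun x => a₀ x * b₀ x)
          (Set.range fun t x => a t x * b t x)) := fun g hg => by
      obtain ⟨c, l, q, hq, hqs⟩ := hab g hg
      exact ⟨c, l, q, hq, Submodule.span_mono (Set.subset_insert _ _) hqs⟩
    rintro g ((hg | hg) | hg)
    · exact hold g (Or.inl (Or.inl hg))
    · exact hold g (Or.inl (Or.inr hg))
    · rcases List.mem_cons.1 hg with rfl | hg
      · exact ⟨c, l, q, hq, hqs⟩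
      · exact hold g (Or.inr hg)

end Jet

theorem MatMulWithin.exists_products {n k : ℕ} (h : MatMulWithin n k) :
    ∃ r ≤ k, ∃ a b : Fin r → (Matrix (Fin n) (Fin n) ℂ × Matrix (Fin n) (Fin n) ℂ) →ₗ[ℂ] ℂ,
      ∀ i j, (fun P : Matrix (Fin n) (Fin n) ℂ × Matrix (Fin n) (Fin n) ℂ => (P.1 * P.2) i j) ∈
        Submodule.span ℂ (Set.range fun t P => a t P * b t P) := by
  obtain ⟨L, hL, hk, hout⟩ := h
  obtain ⟨a, b, hab⟩ := hL.exists_quadraticExpansion (by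
    rintro f ⟨i, j, rfl | rfl⟩
    · exact ⟨Matrix.entryLinearMap ℂ ℂ i j ∘ₗ LinearMap.fst ℂ _ _, rfl⟩
    · exact ⟨Matrix.entryLinearMap ℂ ℂ i j ∘ₗ LinearMap.snd ℂ _ _, rfl⟩)
  refine ⟨L.length, hk, a, b, fun i j => ?_⟩
  obtain ⟨c, l, q, hq, hqs⟩ := hab _ (hout i j)
  rw [hq.eq_of_homogeneous fun t P => by simp [sq, mul_assoc]] at hqs
  exact hqs

/-- The n² entries of the product are linearly independent functions in a span of at most k
products. -/
theorem MatMulWithin.sq_le {n k : ℕ} (h : MatMulWithin n k) : n ^ 2 ≤ k := by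
  obtain ⟨r, hr, a, b, hab⟩ := h.exists_products
  have hli : LinearIndependent ℂ (fun (ij : Fin n × Fin n)
      (P : Matrix (Fin n) (Fin n) ℂ × Matrix (Fin n) (Fin n) ℂ) => (P.1 * P.2) ij.1 ij.2) := by
    rw [Fintype.linearIndependent_iff]
    intro g hg ij
    -- Evaluating at a matrix unit and the identity isolates one coefficient.
    have := congrFun hg (Matrix.single ij.1 ij.2 1, 1)
    simpa [Finset.sum_apply, Matrix.single_apply, ← Prod.ext_iff, Prod.forall,
      ← ite_and, Finset.sum_ite_eq, eq_comm] using this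
  have hmem : Set.range (fun (ij : Fin n × Fin n)
      (P : Matrix (Fin n) (Fin n) ℂ × Matrix (Fin n) (Fin n) ℂ) => (P.1 * P.2) ij.1 ij.2) ⊆
      Submodule.span ℂ (Set.range fun t P => a t P * b t P) := by
    rintro _ ⟨ij, rfl⟩
    exact hab ij.1 ij.2
  have := Module.Finite.span_of_finite ℂ (Set.finite_range fun t P => a t P * b t P)
  have h1 := finrank_span_eq_card hli
  have h2 := Submodule.finrank_mono (Submodule.span_le.2 hmem)
  have h3 := finrank_range_le_card (R := ℂ) (fun t P => a t P * b t P)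
  rw [h1] at h2
  rw [Set.finrank] at h3
  simp only [Fintype.card_prod, Fintype.card_fin] at h2 h3
  nlinarith

/-! ### Tensor rank -/

section TensorRank

variable {I J K I' J' K' I'' J'' K'' : Type*}

/-- The tensor with coefficients `T` is a sum of at most `x` rank-one tensors. -/
def TensorRankLE (T : I → J → K → ℂ) (x : ℝ) : Prop :=
  ∃ r : ℕ, (r : ℝ) ≤ x ∧ ∃ (u : Fin r → I → ℂ) (v : Fin r → J → ℂ) (w : Fin r → K → ℂ),
    ∀ i j k, T i j k = ∑ t, u t i * v t j * w t k

/-- The Kronecker product of two tensors. -/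
def tensorKronecker (T : I → J → K → ℂ) (T' : I' → J' → K' → ℂ) :
    I × I' → J × J' → K × K' → ℂ :=
  fun i j k => T i.1 j.1 k.1 * T' i.2 j.2 k.2

namespace TensorRankLE

theorem of_fintype {ι : Type*} [Fintype ι] {T : I → J → K → ℂ} (u : ι → I → ℂ) (v : ι → J → ℂ)
    (w : ι → K → ℂ) (h : ∀ i j k, T i j k = ∑ t, u t i * v t j * w t k) :
    TensorRankLE T (Fintype.card ι) := by
  let e := (Fintype.equivFin ι).symm
  refine ⟨_, le_rfl, u ∘ e, v ∘ e, w ∘ e, fun i j k => ?_⟩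
  rw [h]
  exact (e.sum_comp fun t => u t i * v t j * w t k).symm

theorem mono {T : I → J → K → ℂ} {x y : ℝ} (h : TensorRankLE T x) (hxy : x ≤ y) :
    TensorRankLE T y := by
  obtain ⟨r, hr, h⟩ := h
  exact ⟨r, hr.trans hxy, h⟩

theorem sum {ι : Type*} [Fintype ι] {T : ι → I → J → K → ℂ} {x : ι → ℝ}
    (h : ∀ a, TensorRankLE (T a) (x a)) :
    TensorRankLE (fun i j k => ∑ a, T a i j k) (∑ a, x a) := by
  choose r hr u v w huvw using h
  refine (of_fintype (ι := Σ a, Fin (r a)) (fun t => u t.1 t.2) (fun t => v t.1 t.2)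
    (fun t => w t.1 t.2) fun i j k => ?_).mono ?_
  · rw [Fintype.sum_sigma]
    exact Finset.sum_congr rfl fun a _ => huvw a i j k
  · simpa using Finset.sum_le_sum fun a (_ : a ∈ Finset.univ) => hr a

theorem comap {T : I → J → K → ℂ} {x : ℝ} (h : TensorRankLE T x) (f : I' → I) (g : J' → J)
    (e : K' → K) : TensorRankLE (fun i j k => T (f i) (g j) (e k)) x := by
  obtain ⟨r, hr, u, v, w, h⟩ := h
  exact ⟨r, hr, fun t => u t ∘ f, fun t => v t ∘ g, fun t => w t ∘ e, fun i j k => h _ _ _⟩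

theorem rotate {T : I → J → K → ℂ} {x : ℝ} (h : TensorRankLE T x) :
    TensorRankLE (fun j k i => T i j k) x := by
  obtain ⟨r, hr, u, v, w, h⟩ := h
  refine ⟨r, hr, v, w, u, fun j k i => ?_⟩
  beta_reduce
  rw [h]
  exact Finset.sum_congr rfl fun t _ => by ring

theorem kronecker {T : I → J → K → ℂ} {T' : I' → J' → K' → ℂ} {x y : ℝ} (h : TensorRankLE T x)
    (h' : TensorRankLE T' y) : TensorRankLE (tensorKronecker T T') (x * y) := by
  obtain ⟨r, hr, u, v, w, h⟩ := h
  obtain ⟨r', hr', u', v', w', h'⟩ := h'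
  refine (of_fintype (ι := Fin r × Fin r') (fun t i => u t.1 i.1 * u' t.2 i.2)
    (fun t j => v t.1 j.1 * v' t.2 j.2) (fun t k => w t.1 k.1 * w' t.2 k.2) fun i j k => ?_).mono ?_
  · rw [tensorKronecker, h, h', Finset.sum_mul_sum, Fintype.sum_prod_type]
    exact Finset.sum_congr rfl fun t _ => Finset.sum_congr rfl fun t' _ => by ring
  · simp only [Fintype.card_prod, Fintype.card_fin, Nat.cast_mul]
    exact mul_le_mul hr hr' (Nat.cast_nonneg _) ((Nat.cast_nonneg _).trans hr)

/-- Linear maps applied to the factor T send each rank-one term of T ⊗ T' to a rank-one term. -/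
theorem kronecker_restrict [Fintype I] [Fintype J] [Fintype K] {T : I → J → K → ℂ}
    {T' : I' → J' → K' → ℂ} {x : ℝ} (h : TensorRankLE (tensorKronecker T T') x)
    (a : I'' → I → ℂ) (b : J'' → J → ℂ) (c : K'' → K → ℂ) :
    TensorRankLE (tensorKronecker
      (fun i j k => ∑ i', ∑ j', ∑ k', a i i' * b j j' * c k k' * T i' j' k') T') x := by
  obtain ⟨r, hr, u, v, w, h⟩ := h
  refine ⟨r, hr, fun t i => ∑ i', a i.1 i' * u t (i', i.2),
    fun t j => ∑ j', b j.1 j' * v t (j', j.2),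
    fun t k => ∑ k', c k.1 k' * w t (k', k.2), fun i j k => ?_⟩
  have h' : ∀ i' j' k', T i' j' k' * T' i.2 j.2 k.2 =
      ∑ t, u t (i', i.2) * v t (j', j.2) * w t (k', k.2) := fun i' j' k' =>
    h (i', i.2) (j', j.2) (k', k.2)
  have h₃ : ∀ t, (∑ i', a i.1 i' * u t (i', i.2)) * (∑ j', b j.1 j' * v t (j', j.2)) *
      (∑ k', c k.1 k' * w t (k', k.2)) = ∑ i', ∑ j', ∑ k', a i.1 i' * b j.1 j' * c k.1 k' *
        (u t (i', i.2) * v t (j', j.2) * w t (k', k.2)) := fun t => by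
    rw [Finset.sum_mul_sum, Finset.sum_mul]
    refine Finset.sum_congr rfl fun i' _ => ?_
    rw [Finset.sum_mul]
    refine Finset.sum_congr rfl fun j' _ => ?_
    rw [Finset.mul_sum]
    exact Finset.sum_congr rfl fun k' _ => by ring
  simp only [tensorKronecker, h₃]
  conv_rhs => rw [Finset.sum_comm]
  rw [Finset.sum_mul]
  refine Finset.sum_congr rfl fun i' _ => ?_
  conv_rhs => rw [Finset.sum_comm]
  rw [Finset.sum_mul]
  refine Finset.sum_congr rfl fun j' _ => ?_
  conv_rhs => rw [Finset.sum_comm]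
  rw [Finset.sum_mul]
  refine Finset.sum_congr rfl fun k' _ => ?_
  rw [mul_assoc, h', Finset.mul_sum]

end TensorRankLE

/-- The tensor of the multiplication of an `A × B` matrix by a `B × C` matrix. -/
def matMulTensor (A B C : Type*) [DecidableEq A] [DecidableEq B] [DecidableEq C] :
    A × B → B × C → C × A → ℂ :=
  fun x y z => if x.2 = y.1 ∧ y.2 = z.1 ∧ z.2 = x.1 then 1 else 0

/-! ### Symmetries and Kronecker products of matrix multiplication tensors -/

section MatMulTensor

variable {A B C A' B' C' : Type*} [DecidableEq A] [DecidableEq B] [DecidableEq C]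
  [DecidableEq A'] [DecidableEq B'] [DecidableEq C'] {x y : ℝ}

theorem TensorRankLE.matMul_rotate (h : TensorRankLE (matMulTensor A B C) x) :
    TensorRankLE (matMulTensor B C A) x := by
  convert h.rotate using 5
  simp only [matMulTensor]
  congr 1
  simp only [eq_iff_iff]
  tauto

theorem TensorRankLE.matMul_equiv (h : TensorRankLE (matMulTensor A B C) x) (e : A' ≃ A)
    (f : B' ≃ B) (g : C' ≃ C) : TensorRankLE (matMulTensor A' B' C') x := by
  convert h.comap (Prod.map e f) (Prod.map f g) (Prod.map g e) using 5
  simp [matMulTensor]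

theorem TensorRankLE.matMul_of_card [Fintype A] [Fintype B] [Fintype C] [Fintype A'] [Fintype B']
    [Fintype C'] (h : TensorRankLE (matMulTensor A B C) x)
    (hA : Fintype.card A' = Fintype.card A) (hB : Fintype.card B' = Fintype.card B)
    (hC : Fintype.card C' = Fintype.card C) : TensorRankLE (matMulTensor A' B' C') x :=
  h.matMul_equiv (Fintype.equivOfCardEq hA) (Fintype.equivOfCardEq hB) (Fintype.equivOfCardEq hC)

theorem matMulTensor_prod (i : (A × A') × (B × B')) (j : (B × B') × (C × C'))
    (k : (C × C') × (A × A')) :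
    matMulTensor (A × A') (B × B') (C × C') i j k =
      tensorKronecker (matMulTensor A B C) (matMulTensor A' B' C')
        ((i.1.1, i.2.1), (i.1.2, i.2.2)) ((j.1.1, j.2.1), (j.1.2, j.2.2))
        ((k.1.1, k.2.1), (k.1.2, k.2.2)) := by
  simp only [matMulTensor, tensorKronecker, Prod.ext_iff, ite_zero_mul_ite_zero, mul_one]
  congr 1
  simp only [eq_iff_iff]
  tauto

theorem tensorRankLE_matMul_prod_iff :
    TensorRankLE (matMulTensor (A × A') (B × B') (C × C')) x ↔
      TensorRankLE (tensorKronecker (matMulTensor A B C) (matMulTensor A' B' C')) x := by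
  constructor
  · intro h
    convert h.comap (fun i : (A × B) × (A' × B') => ((i.1.1, i.2.1), (i.1.2, i.2.2)))
      (fun j : (B × C) × (B' × C') => ((j.1.1, j.2.1), (j.1.2, j.2.2)))
      (fun k : (C × A) × (C' × A') => ((k.1.1, k.2.1), (k.1.2, k.2.2))) using 4
    rw [matMulTensor_prod]
  · intro h
    convert h.comap (fun i : (A × A') × (B × B') => ((i.1.1, i.2.1), (i.1.2, i.2.2)))
      (fun j : (B × B') × (C × C') => ((j.1.1, j.2.1), (j.1.2, j.2.2)))
      (fun k : (C × C') × (A × A') => ((k.1.1, k.2.1), (k.1.2, k.2.2))) using 4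
    exact matMulTensor_prod _ _ _

/-- The Kronecker product of the three cyclic rotations of ⟨A,B,C⟩ is square of side |A||B||C|. -/
theorem TensorRankLE.matMul_cube [Fintype A] [Fintype B] [Fintype C] {q : ℕ}
    (h : TensorRankLE (matMulTensor A B C) x)
    (hq : q = Fintype.card A * Fintype.card B * Fintype.card C) :
    TensorRankLE (matMulTensor (Fin q) (Fin q) (Fin q)) (x ^ 3) := by
  have h₁ := h.matMul_rotate
  have h₂ := h₁.matMul_rotate
  have h₃ := tensorRankLE_matMul_prod_iff.2
    ((tensorRankLE_matMul_prod_iff.2 (h.kronecker h₁)).kronecker h₂)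
  refine (h₃.matMul_of_card ?_ ?_ ?_).mono (le_of_eq (by ring)) <;>
    simp only [Fintype.card_prod, Fintype.card_fin, hq] <;> ring

theorem tensorRankLE_matMul_trivial [Fintype A] [Fintype B] [Fintype C] :
    TensorRankLE (matMulTensor A B C)
      (Fintype.card A * Fintype.card B * Fintype.card C : ℝ) := by
  refine (TensorRankLE.of_fintype (ι := A × B × C)
    (fun t i => if i = (t.1, t.2.1) then 1 else 0) (fun t j => if j = (t.2.1, t.2.2) then 1 else 0)
    (fun t k => if k = (t.2.2, t.1) then 1 else 0) ?_).mono (by simp [mul_assoc])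
  rintro ⟨a, b⟩ ⟨b', c⟩ ⟨c', a'⟩
  simp only [matMulTensor, Fintype.sum_prod_type, Prod.mk.injEq, ite_zero_mul_ite_zero, mul_one]
  rw [Finset.sum_eq_single a, Finset.sum_eq_single b, Finset.sum_eq_single c]
  · congr 1
    simp only [eq_iff_iff]
    tauto
  all_goals simp +contextual [eq_comm]

end MatMulTensor

end TensorRank

/-- The linear forms may mix both matrices. The part of a·b bilinear in (A, B) is a(A,0)b(0,B) +
b(A,0)a(0,B), whence the factor 2. -/
theorem MatMulWithin.tensorRankLE {n k : ℕ} (h : MatMulWithin n k) :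
    TensorRankLE (matMulTensor (Fin n) (Fin n) (Fin n)) (2 * k) := by
  obtain ⟨r, hr, a, b, hab⟩ := h.exists_products
  have hab' : ∀ i j : Fin n, ∃ c : Fin r → ℂ, ∀ A B : Matrix (Fin n) (Fin n) ℂ,
      (A * B) i j = ∑ t, c t * (a t (A, B) * b t (A, B)) := by
    intro i j
    obtain ⟨c, hc⟩ := (Submodule.mem_span_range_iff_exists_fun ℂ).1 (hab i j)
    exact ⟨c, fun A B => by simpa using (congrFun hc (A, B)).symm⟩
  choose c hc using hab'
  refine (TensorRankLE.of_fintype (ι := Fin r ⊕ Fin r)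
    (fun t x => Sum.elim (fun s => a s (Matrix.single x.1 x.2 1, 0))
      (fun s => b s (Matrix.single x.1 x.2 1, 0)) t)
    (fun t x => Sum.elim (fun s => b s (0, Matrix.single x.1 x.2 1))
      (fun s => a s (0, Matrix.single x.1 x.2 1)) t)
    (fun t x => Sum.elim (fun s => c x.2 x.1 s) (fun s => c x.2 x.1 s) t) ?_).mono ?_
  · rintro ⟨i, j⟩ ⟨j', l⟩ ⟨l', i'⟩
    set A := Matrix.single i j (1 : ℂ)
    set B := Matrix.single j' l (1 : ℂ)
    have h₀ := hc i' l' A B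
    have h₁ := hc i' l' A 0
    have h₂ := hc i' l' 0 B
    rw [Matrix.mul_zero, Matrix.zero_apply] at h₁
    rw [Matrix.zero_mul, Matrix.zero_apply] at h₂
    have hAB : (A, B) = (A, 0) + (0, B) := by simp
    have hlhs : matMulTensor (Fin n) (Fin n) (Fin n) (i, j) (j', l) (l', i') = (A * B) i' l' := by
      simp only [A, B, matMulTensor]
      by_cases hj : j = j'
      · subst hj
        simp [Matrix.single_apply, and_comm, eq_comm]
      · simp [Matrix.single_mul_single_of_ne, hj]
    rw [hlhs, h₀, Fintype.sum_sum_type, ← Finset.sum_add_distrib]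
    simp only [Sum.elim_inl, Sum.elim_inr]
    -- Polarization: the sums at (A, 0) and (0, B) vanish because A·0 = 0·B = 0, so subtracting them
    -- leaves the mixed terms.
    rw [← sub_zero (∑ t, _), ← sub_zero (∑ t, _ - 0)]
    nth_rewrite 1 [h₁]
    rw [h₂, ← Finset.sum_sub_distrib, ← Finset.sum_sub_distrib]
    refine Finset.sum_congr rfl fun t _ => ?_
    rw [hAB, map_add, map_add]
    ring
  · simp only [Fintype.card_sum, Fintype.card_fin, Nat.cast_add]
    have : (r : ℝ) ≤ k := by exact_mod_cast hr
    linarith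

/-! ### Fast matrix multiplication by recursion -/

section Recursion

variable {ι κ : Type*} [Fintype ι] [Fintype κ]

/-- Two square matrices of functions, indexed by `ι`, can be multiplied with at most `k`
operations. -/
def MatrixProductWithin (ι : Type*) [Fintype ι] (k : ℕ) : Prop :=
  ∀ (X : Type) (A B : ι → ι → X → ℂ),
    ComputesWithin ((Set.range fun p : ι × ι => A p.1 p.2) ∪ Set.range fun p : ι × ι => B p.1 p.2)
      (Set.range fun (p : ι × ι) x => ∑ l, A p.1 l x * B l p.2 x) k

theorem ComputesWithin.range {ι X : Type*} [Fintype ι] {inputs : Set (X → ℂ)} {f : ι → X → ℂ}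
    {k : ℕ} (h : ∀ i, ComputesWithin inputs {f i} k) :
    ComputesWithin inputs (Set.range f) (Fintype.card ι * k) := by
  simpa [Set.iUnion_singleton_eq_range] using ComputesWithin.iUnion h

theorem MatrixProductWithin.matMulWithin {n k : ℕ} (h : MatrixProductWithin (Fin n) k) :
    MatMulWithin n k := by
  obtain ⟨L, hL, hlen, hsub⟩ := (h (Matrix (Fin n) (Fin n) ℂ × Matrix (Fin n) (Fin n) ℂ)
    (fun i j P => P.1 i j) (fun i j P => P.2 i j)).inputs_mono (inputs' := matMulInputs n) (by
      rintro _ (⟨⟨i, j⟩, rfl⟩ | ⟨⟨i, j⟩, rfl⟩)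
      · exact ⟨i, j, Or.inl rfl⟩
      · exact ⟨i, j, Or.inr rfl⟩)
  refine ⟨L, hL, hlen, fun i j => hsub ⟨(i, j), ?_⟩⟩
  funext P
  simp [Matrix.mul_apply]

theorem matrixProductWithin_of_card_eq_one (h : Fintype.card ι = 1) :
    MatrixProductWithin ι 1 := by
  intro X A B
  obtain ⟨a, ha⟩ := Fintype.card_eq_one_iff.1 h
  have hu : (Finset.univ : Finset ι) = {a} := by
    ext i
    simp [ha i]
  refine (ComputesWithin.of_arithStep (.mul (f := A a a) (g := B a a)
    (input_mem_availableValues _ (Or.inl ⟨(a, a), rfl⟩))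
    (input_mem_availableValues _ (Or.inr ⟨(a, a), rfl⟩)))).mono ?_ le_rfl
  rintro _ ⟨⟨i, j⟩, rfl⟩
  simp [hu, ha i, ha j]

/-- Pad the matrices with zeros, which are free constants. -/
theorem MatrixProductWithin.of_embedding {k : ℕ} (h : MatrixProductWithin κ k) (e : ι ↪ κ) :
    MatrixProductWithin ι k := by
  intro X A B
  have he : Function.Injective (Prod.map e e) := e.injective.prodMap e.injective
  let ext (A : ι → ι → X → ℂ) : κ → κ → X → ℂ := fun i j =>
    Function.extend (Prod.map e e) (fun p => A p.1 p.2) 0 (i, j)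
  have ext_apply (A : ι → ι → X → ℂ) (i j : ι) : ext A (e i) (e j) = A i j :=
    he.extend_apply (fun p => A p.1 p.2) 0 (i, j)
  have ext_mem (A : ι → ι → X → ℂ) (i j : κ) :
      ext A i j ∈ (Set.range fun p : ι × ι => A p.1 p.2) ∪ {0} := by
    by_cases hij : ∃ p, Prod.map e e p = (i, j)
    · obtain ⟨p, hp⟩ := hij
      simp only [ext, ← hp, he.extend_apply]
      exact Or.inl ⟨p, rfl⟩
    · exact Or.inr (Function.extend_apply' _ _ _ hij)
  have h₁ : ComputesWithin ((Set.range fun p : ι × ι => A p.1 p.2) ∪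
      Set.range fun p : ι × ι => B p.1 p.2)
      ((Set.range fun p : κ × κ => ext A p.1 p.2) ∪ Set.range fun p : κ × κ => ext B p.1 p.2) 0 := by
    refine ⟨[], .nil, le_rfl, ?_⟩
    rintro _ (⟨⟨i, j⟩, rfl⟩ | ⟨⟨i, j⟩, rfl⟩)
    · change ext A i j ∈ _
      rcases ext_mem A i j with hf | hf
      · exact input_mem_availableValues _ (Or.inl hf)
      · rw [Set.mem_singleton_iff.1 hf]
        exact const_mem_availableValues _ _ 0
    · change ext B i j ∈ _
      rcases ext_mem B i j with hf | hf
      · exact input_mem_availableValues _ (Or.inr hf)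
      · rw [Set.mem_singleton_iff.1 hf]
        exact const_mem_availableValues _ _ 0
  refine (h₁.trans (h X (ext A) (ext B))).mono ?_ (by simp)
  rintro _ ⟨⟨i, j⟩, rfl⟩
  refine ⟨(e i, e j), ?_⟩
  funext x
  refine (Fintype.sum_of_injective e e.injective _ _ ?_ ?_).symm
  · intro l hl
    have : ext A (e i) l = 0 := Function.extend_apply' _ _ _ fun ⟨p, hp⟩ =>
      hl ⟨p.2, congrArg Prod.snd hp⟩
    simp [this]
  · intro l
    simp only [ext_apply]

/-- Strassen's recursion: the r products of a bilinear algorithm for Q × Q matrices become products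
of ι × ι blocks. Forming the left factors, the right factors and the outputs costs 2r|Q|²|ι|² each.
-/
theorem MatrixProductWithin.prod {Q : Type*} [Fintype Q] [DecidableEq Q] {k r : ℕ}
    (h : MatrixProductWithin ι k) {u v w : Fin r → Q × Q → ℂ}
    (huvw : ∀ a b c, matMulTensor Q Q Q a b c = ∑ t, u t a * v t b * w t c) :
    MatrixProductWithin (Q × ι) (r * k + 6 * r * Fintype.card Q ^ 2 * Fintype.card ι ^ 2) := by
  intro X A B
  let block (u : Fin r → Q × Q → ℂ) (A : Q × ι → Q × ι → X → ℂ) (t : Fin r) (i j : ι) : X → ℂ :=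
    fun x => ∑ p, u t p * A (p.1, i) (p.2, j) x
  let inA := Set.range fun p : (Q × ι) × (Q × ι) => A p.1 p.2
  let inB := Set.range fun p : (Q × ι) × (Q × ι) => B p.1 p.2
  have hblock (u : Fin r → Q × Q → ℂ) (A : Q × ι → Q × ι → X → ℂ) :
      ComputesWithin (Set.range fun p : (Q × ι) × (Q × ι) => A p.1 p.2)
        (Set.range fun s : Fin r × ι × ι => block u A s.1 s.2.1 s.2.2) _ :=
    ComputesWithin.range fun s => ComputesWithin.linearCombination Finset.univ (u s.1)
      (fun p => A (p.1, s.2.1) (p.2, s.2.2)) fun p _ => ⟨((p.1, s.2.1), (p.2, s.2.2)), rfl⟩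
  have h₁ := ((hblock u A).inputs_mono (inputs' := inA ∪ inB) Set.subset_union_left).union
    ((hblock v B).inputs_mono (inputs' := inA ∪ inB) Set.subset_union_right)
  have h₂ := ComputesWithin.iUnion fun t : Fin r =>
    (h X (block u A t) (block v B t)).inputs_mono (inputs' :=
      (Set.range fun s : Fin r × ι × ι => block u A s.1 s.2.1 s.2.2) ∪
      (Set.range fun s : Fin r × ι × ι => block v B s.1 s.2.1 s.2.2)) (by
        rintro _ (⟨⟨i, j⟩, rfl⟩ | ⟨⟨i, j⟩, rfl⟩)
        · exact Or.inl ⟨(t, i, j), rfl⟩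
        · exact Or.inr ⟨(t, i, j), rfl⟩)
  have h₃ := ComputesWithin.range fun p : (Q × ι) × (Q × ι) =>
    ComputesWithin.linearCombination (inputs := ⋃ t : Fin r, Set.range fun (p : ι × ι) x =>
      ∑ l, block u A t p.1 l x * block v B t l p.2 x) Finset.univ
      -- The third slot of the tensor carries the transposed output position.
      (fun t => w t (p.2.1, p.1.1))
      (fun t x => ∑ l, block u A t p.1.2 l x * block v B t l p.2.2 x)
      fun t _ => Set.mem_iUnion.2 ⟨t, (p.1.2, p.2.2), rfl⟩
  refine ((h₁.trans h₂).trans h₃).mono (le_of_eq ?_) (le_of_eq ?_)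
  · congr 1
    funext ⟨⟨a', i⟩, ⟨c', j⟩⟩ x
    have key : ∀ l, ∑ t, w t (c', a') * (block u A t i l x * block v B t l j x) =
        ∑ b, A (a', i) (b, l) x * B (b, l) (c', j) x := by
      intro l
      have : ∀ t, w t (c', a') * (block u A t i l x * block v B t l j x) =
          ∑ p, ∑ s, u t p * v t s * w t (c', a') *
            (A (p.1, i) (p.2, l) x * B (s.1, l) (s.2, j) x) := by
        intro t
        simp only [block]
        rw [Finset.sum_mul_sum, Finset.mul_sum]
        refine Finset.sum_congr rfl fun p _ => ?_
        rw [Finset.mul_sum]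
        exact Finset.sum_congr rfl fun s _ => by ring
      simp only [this]
      rw [Finset.sum_comm]
      have h' : ∀ p : Q × Q, ∑ t, ∑ s, u t p * v t s * w t (c', a') *
            (A (p.1, i) (p.2, l) x * B (s.1, l) (s.2, j) x) =
          ∑ s : Q × Q, matMulTensor Q Q Q p s (c', a') *
            (A (p.1, i) (p.2, l) x * B (s.1, l) (s.2, j) x) := by
        intro p
        rw [Finset.sum_comm]
        refine Finset.sum_congr rfl fun s _ => ?_
        rw [huvw, Finset.sum_mul]
      simp only [h']
      simp only [Fintype.sum_prod_type, matMulTensor, ite_mul, one_mul, zero_mul]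
      rw [Finset.sum_eq_single a']
      · refine Finset.sum_congr rfl fun b _ => ?_
        rw [Finset.sum_eq_single b, Finset.sum_eq_single c'] <;> simp +contextual [eq_comm]
      · intro a _ ha
        simp [ha.symm]
      · simp
    simp only [Fintype.sum_prod_type_right, Finset.mul_sum]
    conv_rhs => rw [Finset.sum_comm]
    exact (Finset.sum_congr rfl fun l _ => key l).symm
  · simp only [Fintype.card_prod, Fintype.card_fin, Finset.card_univ]
    ring

end Recursion

/-- The cost satisfies M(q^(k+1)) ≤ r M(q^k) + D q^(2k). Since r < ρ and q² ≤ ρ for ρ = q^w, this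
gives M(q^k) = O(ρ^k). -/
theorem exists_matMulWithin_of_tensorRankLE {q : ℕ} {x w : ℝ} (hq : 2 ≤ q) (hw : 2 ≤ w)
    (h : TensorRankLE (matMulTensor (Fin q) (Fin q) (Fin q)) x) (hx : x < (q : ℝ) ^ w) :
    ∃ C : ℝ, ∀ n : ℕ, 1 ≤ n → ∃ k : ℕ, MatMulWithin n k ∧ (k : ℝ) ≤ C * (n : ℝ) ^ w := by
  obtain ⟨r, hr, u, v, t, huvt⟩ := h
  have hq0 : (0 : ℝ) < q := by
    have : 0 < q := by omega
    exact_mod_cast this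
  have hq1 : (1 : ℝ) ≤ q := by exact_mod_cast (by omega : 1 ≤ q)
  set ρ : ℝ := (q : ℝ) ^ w with hρ
  have hρ0 : 0 < ρ := Real.rpow_pos_of_pos hq0 w
  have hρq : (q : ℝ) ^ 2 ≤ ρ := by
    rw [hρ, ← Real.rpow_natCast]
    exact Real.rpow_le_rpow_of_exponent_le hq1 (by simpa using hw)
  have hrρ : 0 < ρ - r := by linarith
  set D : ℝ := 6 * r * q ^ 2 with hD
  have hD0 : 0 ≤ D := by positivity
  -- Chosen so that D ≤ K(ρ - r), which closes the induction; the summand 1 covers k = 0.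
  set K : ℝ := 1 + D / (ρ - r) with hK
  have hK1 : 1 ≤ K := by
    rw [hK]
    linarith [div_nonneg hD0 hrρ.le]
  have hKD : D ≤ K * (ρ - r) := by
    rw [hK, add_mul, div_mul_cancel₀ _ hrρ.ne']
    linarith
  have main : ∀ k : ℕ, ∃ N : ℕ, MatrixProductWithin (Fin (q ^ k)) N ∧ (N : ℝ) ≤ K * ρ ^ k := by
    intro k
    induction k with
    | zero => exact ⟨1, matrixProductWithin_of_card_eq_one (by simp), by simpa using hK1⟩
    | succ k ih =>
      obtain ⟨N, hN, hNK⟩ := ih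
      refine ⟨_, (hN.prod huvt).of_embedding
        (Fintype.equivOfCardEq (by simp [pow_succ'])).toEmbedding, ?_⟩
      simp only [Fintype.card_fin, Nat.cast_add, Nat.cast_mul, Nat.cast_pow, Nat.cast_ofNat]
      have h₁ : ((q : ℝ) ^ k) ^ 2 ≤ ρ ^ k := by
        rw [← pow_mul, mul_comm, pow_mul]
        exact pow_le_pow_left₀ (by positivity) hρq k
      have hρk : 0 ≤ ρ ^ k := by positivity
      calc (r : ℝ) * N + D * ((q : ℝ) ^ k) ^ 2
          ≤ r * (K * ρ ^ k) + D * ρ ^ k := by gcongr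
        _ ≤ r * (K * ρ ^ k) + K * (ρ - r) * ρ ^ k := by gcongr
        _ = K * ρ ^ (k + 1) := by ring
  -- Padding n to the next power of q costs at most the factor ρ.
  refine ⟨K * ρ, fun n hn => ?_⟩
  have hk : n < q ^ (Nat.log q n + 1) := Nat.lt_pow_succ_log_self (by omega) n
  have hk' : q ^ Nat.log q n ≤ n := Nat.pow_log_le_self q (by omega)
  obtain ⟨N, hN, hNK⟩ := main (Nat.log q n + 1)
  refine ⟨N, (hN.of_embedding (Fin.castLEEmb hk.le)).matMulWithin, hNK.trans ?_⟩
  have h₁ : ρ ^ Nat.log q n = ((q ^ Nat.log q n : ℕ) : ℝ) ^ w := by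
    rw [hρ, Nat.cast_pow, ← Real.rpow_natCast, ← Real.rpow_natCast, ← Real.rpow_mul hq0.le,
      ← Real.rpow_mul hq0.le, mul_comm]
  have h₂ : ρ ^ Nat.log q n ≤ (n : ℝ) ^ w := by
    rw [h₁]
    exact Real.rpow_le_rpow (by positivity) (by exact_mod_cast hk') (by linarith)
  rw [pow_succ', ← mul_assoc]
  exact mul_le_mul_of_nonneg_left h₂ (by positivity)

/-! ### The exponent of matrix multiplication -/

theorem two_le_of_isBigO_matMul {w : ℝ} (h : ∀ ε : ℝ, 0 < ε → ∃ C : ℝ, ∀ n : ℕ, 1 ≤ n →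
    ∃ k : ℕ, MatMulWithin n k ∧ (k : ℝ) ≤ C * (n : ℝ) ^ (w + ε)) : 2 ≤ w := by
  by_contra! hw
  obtain ⟨C, hC⟩ := h ((2 - w) / 2) (by linarith)
  have ht : Filter.Tendsto (fun n : ℕ => (n : ℝ) ^ ((2 - w) / 2)) Filter.atTop Filter.atTop :=
    (tendsto_rpow_atTop (by linarith)).comp tendsto_natCast_atTop_atTop
  obtain ⟨n, hn, hn1⟩ := ((ht.eventually_gt_atTop C).and (Filter.eventually_ge_atTop 1)).exists
  obtain ⟨k, hk, hkC⟩ := hC n hn1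
  have hn0 : (0 : ℝ) < n := by exact_mod_cast hn1
  have h₁ : (n : ℝ) ^ (2 : ℝ) ≤ k := by
    rw [Real.rpow_two]
    exact_mod_cast hk.sq_le
  have h₂ : (n : ℝ) ^ (2 : ℝ) = (n : ℝ) ^ ((2 - w) / 2) * (n : ℝ) ^ (w + (2 - w) / 2) := by
    rw [← Real.rpow_add hn0]
    congr 1
    ring
  have h₃ := Real.rpow_pos_of_pos hn0 (w + (2 - w) / 2)
  nlinarith

theorem matMulExponent_le {q : ℕ} {x w : ℝ} (hq : 2 ≤ q) (hw : 2 ≤ w)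
    (h : TensorRankLE (matMulTensor (Fin q) (Fin q) (Fin q)) x) (hx : x < (q : ℝ) ^ w) :
    matMulExponent ≤ w := by
  refine csInf_le ⟨2, fun w hw => two_le_of_isBigO_matMul hw⟩ fun ε hε => ?_
  obtain ⟨C, hC⟩ := exists_matMulWithin_of_tensorRankLE hq
    (by linarith : 2 ≤ w + ε) h (hx.trans_le (Real.rpow_le_rpow_of_exponent_le
      (by exact_mod_cast (by omega : 1 ≤ q)) (by linarith)))
  exact ⟨C, hC⟩

/-- The schoolbook rank 8 for q = 2 lies below 2^(3+ε). Without nonemptiness the infimum would be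
the default value 0. -/
theorem matMulExponent_set_nonempty : {w : ℝ | ∀ ε : ℝ, 0 < ε → ∃ C : ℝ, ∀ n : ℕ, 1 ≤ n →
    ∃ k : ℕ, MatMulWithin n k ∧ (k : ℝ) ≤ C * (n : ℝ) ^ (w + ε)}.Nonempty :=
  ⟨3, fun ε hε => exists_matMulWithin_of_tensorRankLE (le_refl 2) (by linarith)
    tensorRankLE_matMul_trivial (by
      have : (2 : ℝ) ^ (3 : ℝ) < (2 : ℝ) ^ (3 + ε) :=
        Real.rpow_lt_rpow_of_exponent_lt (by norm_num) (by linarith)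
      norm_num at this ⊢
      exact this)⟩

theorem two_le_matMulExponent : 2 ≤ matMulExponent :=
  le_csInf matMulExponent_set_nonempty fun _ hw => two_le_of_isBigO_matMul hw

theorem exists_tensorRankLE_of_matMulExponent_lt {w : ℝ} (hw : matMulExponent < w) :
    ∃ C : ℝ, 0 < C ∧ ∀ n : ℕ, 1 ≤ n →
      TensorRankLE (matMulTensor (Fin n) (Fin n) (Fin n)) (C * (n : ℝ) ^ w) := by
  obtain ⟨w₀, hw₀, hlt⟩ := exists_lt_of_csInf_lt matMulExponent_set_nonempty hw
  obtain ⟨C, hC⟩ := hw₀ (w - w₀) (by linarith)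
  refine ⟨max 1 (2 * C), by positivity, fun n hn => ?_⟩
  obtain ⟨k, hk, hkC⟩ := hC n hn
  rw [add_sub_cancel] at hkC
  refine hk.tensorRankLE.mono ?_
  calc 2 * (k : ℝ) ≤ 2 * C * (n : ℝ) ^ w := by linarith
    _ ≤ max 1 (2 * C) * (n : ℝ) ^ w := by gcongr; exact le_max_right _ _

/-! ### Character degrees and the structure tensor of the group algebra -/

section GroupAlgebra

variable {G : Type*} [Group G]

/-- The orbit of a nonzero vector spans an irreducible representation. The bound makes the supremum
in `maxCharacterDegree` a genuine one. -/
theorem IsCharacterDegree.le_card [Finite G] {d : ℕ} (h : IsCharacterDegree G d) :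
    d ≤ Nat.card G := by
  obtain ⟨ρ, hρ⟩ := h
  rcases Nat.eq_zero_or_pos d with rfl | hd
  · exact Nat.zero_le _
  have := Fintype.ofFinite G
  have : NeZero d := ⟨hd.ne'⟩
  let v : Fin d → ℂ := Pi.single 0 1
  let W : Subrepresentation ρ := ⟨Submodule.span ℂ (Set.range fun g => ρ g v), fun g x hx => by
    have hle : Submodule.span ℂ (Set.range fun g => ρ g v) ≤
        (Submodule.span ℂ (Set.range fun g => ρ g v)).comap (ρ g) := by
      rw [Submodule.span_le]
      rintro _ ⟨k, rfl⟩
      refine Submodule.subset_span ⟨g * k, ?_⟩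
      simp [map_mul]
    exact hle hx⟩
  have hv : v ∈ W.toSubmodule := Submodule.subset_span ⟨1, by simp⟩
  have hW : W = ⊤ := by
    refine (eq_bot_or_eq_top W).resolve_left fun hbot => ?_
    rw [hbot] at hv
    have hv0 : v = 0 := (Submodule.mem_bot ℂ).1 hv
    simpa [v] using congrFun hv0 0
  have hspan : Submodule.span ℂ (Set.range fun g => ρ g v) = ⊤ :=
    congrArg Subrepresentation.toSubmodule hW
  have := finrank_range_le_card (R := ℂ) (fun g => ρ g v)
  rw [Set.finrank, hspan, finrank_top, Module.finrank_fin_fun] at this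
  rwa [Nat.card_eq_fintype_card]

theorem IsCharacterDegree.le_max [Finite G] {d : ℕ} (h : IsCharacterDegree G d) :
    d ≤ maxCharacterDegree G :=
  le_csSup ⟨Nat.card G, fun _ h => h.le_card⟩ h

theorem isCharacterDegree_of_surjective {d : ℕ} (hd : d ≠ 0)
    (φ : MonoidAlgebra ℂ G →ₐ[ℂ] Matrix (Fin d) (Fin d) ℂ) (hφ : Function.Surjective φ) :
    IsCharacterDegree G d := by
  have : NeZero d := ⟨hd⟩
  let ρ : Representation ℂ G (Fin d → ℂ) :=
    ((Matrix.toLinAlgEquiv' : Matrix (Fin d) (Fin d) ℂ ≃ₐ[ℂ] _) :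
      Matrix (Fin d) (Fin d) ℂ →* ((Fin d → ℂ) →ₗ[ℂ] (Fin d → ℂ))).comp
      ((φ : MonoidAlgebra ℂ G →* _).comp (MonoidAlgebra.of ℂ G))
  have hρ : ∀ g v, ρ g v = (φ (MonoidAlgebra.of ℂ G g)).mulVec v := fun g v => rfl
  have hinv : ∀ (W : Subrepresentation ρ) (x : MonoidAlgebra ℂ G), ∀ v ∈ W.toSubmodule,
      (φ x).mulVec v ∈ W.toSubmodule := by
    intro W x v hv
    induction x using MonoidAlgebra.induction_on with
    | of g => exact W.apply_mem_toSubmodule g hv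
    | add x y hx hy =>
      rw [map_add, Matrix.add_mulVec]
      exact add_mem hx hy
    | smul c x hx =>
      rw [map_smul, Matrix.smul_mulVec]
      exact Submodule.smul_mem _ c hx
  refine ⟨ρ, ?_⟩
  have hnt : Nontrivial (Subrepresentation ρ) := by
    refine ⟨⊥, ⊤, fun h => ?_⟩
    have h' : (⊥ : Submodule ℂ (Fin d → ℂ)) = ⊤ := congrArg Subrepresentation.toSubmodule h
    exact bot_ne_top h'
  refine { eq_bot_or_eq_top := fun W => ?_ }
  rw [or_iff_not_imp_left]
  intro hW
  have hW' : W.toSubmodule ≠ ⊥ := fun h => hW (Subrepresentation.toSubmodule_injective h)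
  obtain ⟨v, hv, hv0⟩ := Submodule.exists_mem_ne_zero_of_ne_bot hW'
  obtain ⟨j, hj⟩ := Function.ne_iff.1 hv0
  apply Subrepresentation.toSubmodule_injective
  change W.toSubmodule = ⊤
  rw [Submodule.eq_top_iff']
  intro u
  -- This rank-one matrix sends v to u, so the nonzero invariant subspace contains every u.
  obtain ⟨x, hx⟩ := hφ (Matrix.vecMulVec u (Pi.single j (v j)⁻¹))
  have := hinv W x v hv
  rw [hx, Matrix.vecMulVec_mulVec] at this
  simpa [single_dotProduct, inv_mul_cancel₀ hj] using this

/-- The structure tensor of the group algebra in its trilinear form. -/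
def groupTensor (G : Type*) [Group G] [DecidableEq G] : G → G → G → ℂ :=
  fun g h k => if g * h * k = 1 then 1 else 0

/-- The group tensor is the coefficient of 1 in the product ghk. Transported through the Wedderburn
isomorphism, this functional is a sum of linear functionals of the blocks. -/
theorem exists_groupTensor_decomposition [Finite G] [DecidableEq G] :
    ∃ (s : ℕ) (d : Fin s → ℕ), (∀ i, d i ≠ 0) ∧ (∀ i, IsCharacterDegree G (d i)) ∧
      ∑ i, d i ^ 2 = Nat.card G ∧
      ∃ a b c : ∀ i, G → Fin (d i) × Fin (d i) → ℂ, ∀ g h k, groupTensor G g h k =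
        ∑ i, ∑ x, ∑ y, ∑ z, a i g x * b i h y * c i k z *
          matMulTensor (Fin (d i)) (Fin (d i)) (Fin (d i)) x y z := by
  have := Fintype.ofFinite G
  have : Module.Finite ℂ (MonoidAlgebra ℂ G) :=
    Module.Finite.equiv (MonoidAlgebra.coeffLinearEquiv ℂ).symm
  have : NeZero (Nat.card G : ℂ) := ⟨by simp⟩
  obtain ⟨s, d, hd, ⟨e⟩⟩ :=
    IsSemisimpleRing.exists_algEquiv_pi_matrix_of_isAlgClosed ℂ (MonoidAlgebra ℂ G)
  refine ⟨s, d, fun i => (hd i).ne, fun i => ?_, ?_, ?_⟩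
  · refine isCharacterDegree_of_surjective (hd i).ne
      ((Pi.evalAlgHom ℂ (fun i => Matrix (Fin (d i)) (Fin (d i)) ℂ) i).comp (e : _ →ₐ[ℂ] _)) ?_
    exact (Function.surjective_eval i).comp e.surjective
  · have h₁ := e.toLinearEquiv.finrank_eq
    rw [(MonoidAlgebra.coeffLinearEquiv ℂ).finrank_eq, Module.finrank_finsupp_self,
      Module.finrank_pi_fintype] at h₁
    simp only [Module.finrank_matrix, Module.finrank_self, Fintype.card_fin, mul_one] at h₁
    rw [Nat.card_eq_fintype_card, h₁]
    exact Finset.sum_congr rfl fun i _ => sq _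
  · let coeffOne : MonoidAlgebra ℂ G →ₗ[ℂ] ℂ :=
      Finsupp.lapply 1 ∘ₗ (MonoidAlgebra.coeffLinearEquiv ℂ).toLinearMap
    let lam := coeffOne ∘ₗ e.symm.toLinearMap
    let c₀ : ∀ i, Fin (d i) → Fin (d i) → ℂ := fun i p q =>
      lam (Pi.single i (Matrix.single p q 1))
    have hlam : ∀ M, lam M = ∑ i, ∑ p, ∑ q, M i p q * c₀ i p q := by
      intro M
      conv_lhs => rw [← Finset.univ_sum_single M]
      rw [map_sum]
      refine Finset.sum_congr rfl fun i _ => ?_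
      conv_lhs => rw [Matrix.matrix_eq_sum_single (M i)]
      have : ∀ x : Matrix (Fin (d i)) (Fin (d i)) ℂ, lam (Pi.single i x) =
        (lam ∘ₗ LinearMap.single ℂ _ i) x := fun x => rfl
      rw [this]
      simp only [map_sum]
      refine Finset.sum_congr rfl fun p _ => Finset.sum_congr rfl fun q _ => ?_
      have h₁ : Matrix.single p q (M i p q) = M i p q • Matrix.single p q (1 : ℂ) := by simp
      rw [h₁, map_smul, smul_eq_mul]
      rfl
    have hgroup : ∀ g h k, groupTensor G g h k =
        lam (e (MonoidAlgebra.of ℂ G g) * e (MonoidAlgebra.of ℂ G h) *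
          e (MonoidAlgebra.of ℂ G k)) := by
      intro g h k
      rw [← map_mul, ← map_mul, ← map_mul, ← map_mul]
      change _ = coeffOne (e.symm (e _))
      rw [e.symm_apply_apply]
      change _ = (MonoidAlgebra.single (g * h * k) (1 : ℂ)).coeff 1
      rw [MonoidAlgebra.coeff_single, Finsupp.single_apply]
      rfl
    -- On each block the form is tr(M₁M₂M₃c₀ᵀ); absorbing c₀ᵀ into the third factor leaves the
    -- matrix multiplication tensor.
    refine ⟨fun i g x => e (MonoidAlgebra.of ℂ G g) i x.1 x.2,
      fun i g x => e (MonoidAlgebra.of ℂ G g) i x.1 x.2,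
      fun i g x => ∑ q, e (MonoidAlgebra.of ℂ G g) i x.1 q * c₀ i x.2 q, fun g h k => ?_⟩
    rw [hgroup, hlam]
    refine Finset.sum_congr rfl fun i _ => ?_
    dsimp only
    generalize e (MonoidAlgebra.of ℂ G g) = M₁
    generalize e (MonoidAlgebra.of ℂ G h) = M₂
    generalize e (MonoidAlgebra.of ℂ G k) = M₃
    have hR : ∀ p b, ∑ y : Fin (d i) × Fin (d i), ∑ z : Fin (d i) × Fin (d i),
        M₁ i p b * M₂ i y.1 y.2 * (∑ q, M₃ i z.1 q * c₀ i z.2 q) *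
          matMulTensor (Fin (d i)) (Fin (d i)) (Fin (d i)) (p, b) y z =
        ∑ c, M₁ i p b * M₂ i b c * ∑ q, M₃ i c q * c₀ i p q := by
      intro p b
      simp only [Fintype.sum_prod_type, matMulTensor, mul_ite, mul_one, mul_zero]
      rw [Finset.sum_eq_single b]
      · refine Finset.sum_congr rfl fun c _ => ?_
        rw [Finset.sum_eq_single c, Finset.sum_eq_single p] <;> simp +contextual [eq_comm]
      · intro b' _ hb
        simp [hb.symm]
      · simp
    rw [Fintype.sum_prod_type]
    simp only [hR]
    simp only [Pi.mul_apply, Matrix.mul_apply, Finset.sum_mul, Finset.mul_sum]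
    refine Finset.sum_congr rfl fun p _ => ?_
    have : ∀ q, ∑ c, ∑ b, M₁ i p b * M₂ i b c * M₃ i c q * c₀ i p q =
        ∑ b, ∑ c, M₁ i p b * M₂ i b c * M₃ i c q * c₀ i p q := fun q => Finset.sum_comm
    simp only [this]
    rw [Finset.sum_comm]
    refine Finset.sum_congr rfl fun b _ => ?_
    rw [Finset.sum_comm]
    exact Finset.sum_congr rfl fun c _ => Finset.sum_congr rfl fun q _ => by ring

end GroupAlgebra

/-! ### The triple product property -/

section TripleProduct

variable {G : Type*} [Group G]

theorem TripleProductProperty.eq_of_mul_eq_one {S T U : Finset G}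
    (h : TripleProductProperty S T U) {s s' t t' u u' : G} (hs : s ∈ S) (hs' : s' ∈ S)
    (ht : t ∈ T) (ht' : t' ∈ T) (hu : u ∈ U) (hu' : u' ∈ U)
    (h1 : s' * s⁻¹ * (t * t'⁻¹) * (u * u'⁻¹) = 1) : s' = s ∧ t = t' ∧ u = u' := by
  obtain ⟨h₁, h₂, h₃⟩ :=
    h _ ⟨s', hs', s, hs, rfl⟩ _ ⟨t, ht, t', ht', rfl⟩ _ ⟨u, hu, u', hu', rfl⟩ h1
  exact ⟨mul_inv_eq_one.1 h₁, mul_inv_eq_one.1 h₂, mul_inv_eq_one.1 h₃⟩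

/-- Conjugation by s' turns s⁻¹t · t'⁻¹u · u'⁻¹s' = 1 into a product of three quotients equal to 1,
to which the triple product property applies. -/
theorem TripleProductProperty.matMulTensor_eq [DecidableEq G] {S T U : Finset G}
    (h : TripleProductProperty S T U) (x : S × T) (y : T × U) (z : U × S) :
    matMulTensor S T U x y z = groupTensor G ((x.1 : G)⁻¹ * x.2) ((y.1 : G)⁻¹ * y.2)
      ((z.1 : G)⁻¹ * z.2) := by
  obtain ⟨s, t⟩ := x
  obtain ⟨t', u⟩ := y
  obtain ⟨u', s'⟩ := z
  simp only [matMulTensor, groupTensor]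
  congr 1
  rw [eq_iff_iff]
  constructor
  · rintro ⟨rfl, rfl, rfl⟩
    group
  · intro h1
    have h2 : (s' : G) * (s : G)⁻¹ * (t * (t' : G)⁻¹) * (u * (u' : G)⁻¹) = 1 := by
      have := congrArg (fun g : G => (s' : G) * g * (s' : G)⁻¹) h1
      simpa [mul_assoc] using this
    obtain ⟨h₁, h₂, h₃⟩ := h.eq_of_mul_eq_one s.2 s'.2 t.2 t'.2 u.2 u'.2 h2
    exact ⟨Subtype.ext h₂, Subtype.ext h₃, Subtype.ext h₁⟩

/-- Tensor powers of `⟨n, m, p⟩` embed into tensor powers of the group algebra. -/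
theorem TripleProductProperty.tensorRankLE [DecidableEq G] {S T U : Finset G}
    (h : TripleProductProperty S T U) {s : ℕ} {d : Fin s → ℕ} (hd : ∀ i, d i ≠ 0)
    {a b c : ∀ i, G → Fin (d i) × Fin (d i) → ℂ}
    (habc : ∀ g h k, groupTensor G g h k =
        ∑ i, ∑ x, ∑ y, ∑ z, a i g x * b i h y * c i k z *
          matMulTensor (Fin (d i)) (Fin (d i)) (Fin (d i)) x y z)
    {C w : ℝ} (hC : ∀ n : ℕ, 1 ≤ n →
      TensorRankLE (matMulTensor (Fin n) (Fin n) (Fin n)) (C * (n : ℝ) ^ w)) (N : ℕ) :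
    ∀ e : ℕ, 1 ≤ e → TensorRankLE
      (matMulTensor (Fin (S.card ^ N * e)) (Fin (T.card ^ N * e)) (Fin (U.card ^ N * e)))
      (C * (e : ℝ) ^ w * (∑ i, (d i : ℝ) ^ w) ^ N) := by
  -- The auxiliary size e accumulates the block sizes: trading one copy of ⟨n,m,p⟩ for the block d_i
  -- replaces e by d_i e. The constant C is therefore paid only once, at N = 0.
  induction N with
  | zero =>
    intro e he
    refine ((hC e he).matMul_of_card ?_ ?_ ?_).mono (by simp) <;> simp
  | succ N ih =>
    intro e he
    let X := matMulTensor (Fin (S.card ^ N * e)) (Fin (T.card ^ N * e)) (Fin (U.card ^ N * e))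
    have h₁ : ∀ i, TensorRankLE (tensorKronecker
        (fun g h k => ∑ x, ∑ y, ∑ z, a i g x * b i h y * c i k z *
          matMulTensor (Fin (d i)) (Fin (d i)) (Fin (d i)) x y z) X)
        (C * ((d i * e : ℕ) : ℝ) ^ w * (∑ i, (d i : ℝ) ^ w) ^ N) := fun i => by
      refine TensorRankLE.kronecker_restrict (tensorRankLE_matMul_prod_iff.1
        ((ih (d i * e) (Nat.mul_pos (Nat.pos_of_ne_zero (hd i)) he)).matMul_of_card ?_ ?_ ?_))
        (a i) (b i) (c i) <;>
      · simp only [Fintype.card_prod, Fintype.card_fin]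
        ring
    have h₂ := TensorRankLE.sum h₁
    have h₃ : TensorRankLE (tensorKronecker (matMulTensor S T U) X)
        (∑ i, C * ((d i * e : ℕ) : ℝ) ^ w * (∑ i, (d i : ℝ) ^ w) ^ N) := by
      convert h₂.comap (fun x : (S × T) × _ => ((x.1.1 : G)⁻¹ * x.1.2, x.2))
        (fun x : (T × U) × _ => ((x.1.1 : G)⁻¹ * x.1.2, x.2))
        (fun x : (U × S) × _ => ((x.1.1 : G)⁻¹ * x.1.2, x.2)) using 4
      simp only [tensorKronecker, h.matMulTensor_eq, habc, Finset.sum_mul]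
    refine ((tensorRankLE_matMul_prod_iff.2 h₃).matMul_of_card ?_ ?_ ?_).mono (le_of_eq ?_)
    · simp [pow_succ', mul_assoc]
    · simp [pow_succ', mul_assoc]
    · simp [pow_succ', mul_assoc]
    · rw [pow_succ, ← Finset.sum_mul]
      have : ∀ i, C * ((d i * e : ℕ) : ℝ) ^ w = C * (e : ℝ) ^ w * (d i : ℝ) ^ w := fun i => by
        rw [Nat.cast_mul, Real.mul_rpow (Nat.cast_nonneg _) (Nat.cast_nonneg _)]
        ring
      simp only [this, ← Finset.mul_sum]
      ring

end TripleProduct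

/-! ### Cardinality bounds from the triple product property -/

section TripleProduct

variable {G : Type*} [Group G]

theorem TripleProductProperty.rotate {S T U : Finset G} (h : TripleProductProperty S T U) :
    TripleProductProperty T U S := by
  intro b hb c hc a ha h1
  have h2 : a * b * c = 1 := by
    rw [mul_assoc]
    exact mul_eq_one_comm.1 h1
  obtain ⟨h₁, h₂, h₃⟩ := h a ha b hb c hc h2
  exact ⟨h₂, h₃, h₁⟩

theorem TripleProductProperty.injOn_inv_mul {S T U : Finset G} (h : TripleProductProperty S T U)
    (hU : U.Nonempty) : Set.InjOn (fun x : G × G => x.1⁻¹ * x.2) (S ×ˢ T : Finset (G × G)) := by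
  rintro ⟨s, t⟩ hst ⟨s', t'⟩ hst' heq
  obtain ⟨u, hu⟩ := hU
  simp only [Finset.coe_product, Set.mem_prod, Finset.mem_coe] at hst hst' heq
  obtain ⟨h₁, h₂, -⟩ := h.eq_of_mul_eq_one hst.1 hst'.1 hst.2 hst'.2 hu hu (by
    have : s' * s⁻¹ * (t * t'⁻¹) * (u * u⁻¹) = s' * (s⁻¹ * t) * t'⁻¹ := by group
    rw [this, heq]
    group)
  rw [h₁, h₂]

theorem TripleProductProperty.card_mul_card_le [Finite G] {S T U : Finset G}
    (h : TripleProductProperty S T U) (hU : U.Nonempty) : S.card * T.card ≤ Nat.card G := by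
  have := Fintype.ofFinite G
  rw [← Finset.card_product, Nat.card_eq_fintype_card]
  exact Finset.card_le_card_of_injOn _ (fun _ _ => Finset.mem_univ _) (h.injOn_inv_mul hU)

/-- In case of equality every element of G has the form s⁻¹t. Writing s'⁻¹(uu'⁻¹)⁻¹t' so, with u ≠
u', violates the triple product property. -/
theorem TripleProductProperty.card_mul_card_lt [Finite G] {S T U : Finset G}
    (h : TripleProductProperty S T U) (hU : 2 ≤ U.card) : S.card * T.card < Nat.card G := by
  classical
  have := Fintype.ofFinite G
  have hUne : U.Nonempty := Finset.card_pos.1 (by omega)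
  refine lt_of_le_of_ne (h.card_mul_card_le hUne) fun heq => ?_
  have hpos : 0 < S.card * T.card := heq ▸ Nat.card_pos
  obtain ⟨s', hs'⟩ := Finset.card_pos.1 (Nat.pos_of_mul_pos_right hpos)
  obtain ⟨t', ht'⟩ := Finset.card_pos.1 (Nat.pos_of_mul_pos_left hpos)
  have himg : (S ×ˢ T).image (fun x : G × G => x.1⁻¹ * x.2) = Finset.univ := by
    rw [← Finset.card_eq_iff_eq_univ, Finset.card_image_of_injOn (h.injOn_inv_mul hUne),
      Finset.card_product, heq, Nat.card_eq_fintype_card]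
  obtain ⟨u, hu, u', hu', hne⟩ := Finset.one_lt_card.1 hU
  have hmem : s'⁻¹ * (u * u'⁻¹)⁻¹ * t' ∈ (S ×ˢ T).image (fun x : G × G => x.1⁻¹ * x.2) :=
    himg ▸ Finset.mem_univ _
  obtain ⟨⟨s, t⟩, hst, hx⟩ := Finset.mem_image.1 hmem
  rw [Finset.mem_product] at hst
  refine hne (h.eq_of_mul_eq_one hst.1 hs' hst.2 ht' hu hu' ?_).2.2
  have : s' * s⁻¹ * (t * t'⁻¹) * (u * u'⁻¹) = s' * (s⁻¹ * t) * t'⁻¹ * (u * u'⁻¹) := by group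
  rw [this, hx]
  group

/-- Multiply the bounds nm, mp, pn ≤ |G|; one is strict because some size is at least 2. -/
theorem TripleProductProperty.sq_lt_card_pow [Finite G] {S T U : Finset G}
    (h : TripleProductProperty S T U) (hS : 0 < S.card) (hT : 0 < T.card) (hU : 0 < U.card)
    (hne : ¬ (S.card = 1 ∧ T.card = 1 ∧ U.card = 1)) :
    (S.card * T.card * U.card) ^ 2 < Nat.card G ^ 3 := by
  have h₁ := h.card_mul_card_le (Finset.card_pos.1 hU)
  have h₂ := h.rotate.card_mul_card_le (Finset.card_pos.1 hS)
  have h₃ := h.rotate.rotate.card_mul_card_le (Finset.card_pos.1 hT)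
  have key : ∀ {a b c g : ℕ}, 0 < b → 0 < c → a < g → b ≤ g → c ≤ g → a * b * c < g ^ 3 := by
    intro a b c g hb hc h₁ h₂ h₃
    calc a * b * c < g * b * c := by gcongr
      _ ≤ g * g * g := by gcongr
      _ = g ^ 3 := by ring
  have h12 := Nat.mul_pos hS hT
  have h23 := Nat.mul_pos hT hU
  have h31 := Nat.mul_pos hU hS
  have hcases : 2 ≤ U.card ∨ 2 ≤ S.card ∨ 2 ≤ T.card := by omega
  rcases hcases with h2 | h2 | h2
  · calc _ = S.card * T.card * (T.card * U.card) * (U.card * S.card) := by ring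
      _ < _ := key h23 h31 (h.card_mul_card_lt h2) h₂ h₃
  · calc _ = T.card * U.card * (U.card * S.card) * (S.card * T.card) := by ring
      _ < _ := key h31 h12 (h.rotate.card_mul_card_lt h2) h₃ h₁
  · calc _ = U.card * S.card * (S.card * T.card) * (T.card * U.card) := by ring
      _ < _ := key h12 h23 (h.rotate.rotate.card_mul_card_lt h2) h₁ h₂

/-- In an abelian group (s,t,u) ↦ s⁻¹tu is injective on S × T × U. -/
theorem TripleProductProperty.card_le_of_commGroup {G : Type*} [CommGroup G] [Finite G]
    {S T U : Finset G} (h : TripleProductProperty S T U) :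
    S.card * T.card * U.card ≤ Nat.card G := by
  have := Fintype.ofFinite G
  rw [← Finset.card_product, ← Finset.card_product, Nat.card_eq_fintype_card]
  refine Finset.card_le_card_of_injOn (fun x : (G × G) × G => x.1.1⁻¹ * x.1.2 * x.2)
    (fun _ _ => Finset.mem_univ _) ?_
  rintro ⟨⟨s, t⟩, u⟩ hx ⟨⟨s', t'⟩, u'⟩ hx' heq
  simp only [Finset.coe_product, Set.mem_prod, Finset.mem_coe] at hx hx' heq
  obtain ⟨h₁, h₂, h₃⟩ := h.eq_of_mul_eq_one hx.1.1 hx'.1.1 hx.1.2 hx'.1.2 hx.2 hx'.2 (by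
    have : s' * s⁻¹ * (t * t'⁻¹) * (u * u'⁻¹) = (s⁻¹ * t * u) * (s'⁻¹ * t' * u')⁻¹ := by
      simp only [mul_inv_rev, inv_inv]
      rw [mul_comm s' s⁻¹, mul_mul_mul_comm s⁻¹, mul_comm u'⁻¹, mul_mul_mul_comm _ u,
        mul_comm s' t'⁻¹]
    rw [this, heq, mul_inv_cancel])
  rw [h₁, h₂, h₃]

end TripleProduct

/-! ### The pseudo-exponent -/

section PseudoExponent

variable {G : Type*} [Group G]

/-- The quotients of logarithms whose minimum is the pseudo-exponent. -/
def pseudoExponentSet (G : Type*) [Group G] : Set ℝ :=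
  {x : ℝ | ∃ n m p : ℕ, 0 < n ∧ 0 < m ∧ 0 < p ∧ ¬ (n = 1 ∧ m = 1 ∧ p = 1) ∧
      Realizes G n m p ∧
      x = 3 * Real.log (Nat.card G) / Real.log ((n : ℝ) * (m : ℝ) * (p : ℝ))}

theorem pseudoExponent_eq_sInf [Nontrivial G] : pseudoExponent G = sInf (pseudoExponentSet G) :=
  if_pos ‹_›

theorem pseudoExponentSet_nonempty [Finite G] [Nontrivial G] : (pseudoExponentSet G).Nonempty := by
  have := Fintype.ofFinite G
  have hcard : 1 < Nat.card G := Finite.one_lt_card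
  refine ⟨_, Nat.card G, 1, 1, by omega, one_pos, one_pos, by omega,
    ⟨Finset.univ, {1}, {1}, by simp, by simp, by simp, ?_⟩, rfl⟩
  rintro a - b ⟨_, hs, _, ht, rfl⟩ c ⟨_, hs', _, ht', rfl⟩ h
  simp_all

/-- Finiteness makes the infimum attained, so an optimal triple can be chosen. -/
theorem pseudoExponentSet_finite [Finite G] : (pseudoExponentSet G).Finite := by
  have := Fintype.ofFinite G
  have hle : ∀ S : Finset G, S.card ∈ Set.Iic (Nat.card G) := fun S => by
    rw [Nat.card_eq_fintype_card]
    exact S.card_le_univ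
  refine (((Set.finite_Iic (Nat.card G)).prod ((Set.finite_Iic (Nat.card G)).prod
    (Set.finite_Iic (Nat.card G)))).image fun t : ℕ × ℕ × ℕ => 3 * Real.log (Nat.card G) /
      Real.log ((t.1 : ℝ) * (t.2.1 : ℝ) * (t.2.2 : ℝ))).subset ?_
  rintro _ ⟨_, _, _, -, -, -, -, ⟨S, T, U, rfl, rfl, rfl, -⟩, rfl⟩
  exact ⟨(S.card, T.card, U.card), ⟨hle S, hle T, hle U⟩, rfl⟩

theorem log_mul_mul_pos {n m p : ℕ} (hn : 0 < n) (hm : 0 < m) (hp : 0 < p)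
    (h : ¬ (n = 1 ∧ m = 1 ∧ p = 1)) : 0 < Real.log ((n : ℝ) * (m : ℝ) * (p : ℝ)) := by
  have h1 : 1 < n * m * p := by
    refine lt_of_le_of_ne (Nat.mul_pos (Nat.mul_pos hn hm) hp) fun heq => h ?_
    simpa [and_assoc] using heq.symm
  exact Real.log_pos (by exact_mod_cast h1)

theorem two_lt_pseudoExponent [Finite G] [Nontrivial G] : 2 < pseudoExponent G := by
  rw [pseudoExponent_eq_sInf]
  obtain ⟨_, _, _, hn, hm, hp, hne, ⟨S, T, U, rfl, rfl, rfl, h⟩, hx⟩ :=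
    pseudoExponentSet_nonempty.csInf_mem (pseudoExponentSet_finite (G := G))
  rw [hx, lt_div_iff₀ (log_mul_mul_pos hn hm hp hne)]
  have h₁ : ((S.card : ℝ) * T.card * U.card) ^ 2 < (Nat.card G : ℝ) ^ 3 := by
    exact_mod_cast h.sq_lt_card_pow hn hm hp hne
  have h₂ := Real.log_lt_log (by positivity) h₁
  rw [Real.log_pow, Real.log_pow] at h₂
  exact_mod_cast h₂

theorem three_le_pseudoExponent {G : Type*} [CommGroup G] [Finite G] [Nontrivial G] :
    3 ≤ pseudoExponent G := by
  rw [pseudoExponent_eq_sInf]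
  refine le_csInf pseudoExponentSet_nonempty ?_
  rintro _ ⟨_, _, _, hn, hm, hp, hne, ⟨S, T, U, rfl, rfl, rfl, h⟩, rfl⟩
  rw [le_div_iff₀ (log_mul_mul_pos hn hm hp hne)]
  have h₁ : (S.card : ℝ) * T.card * U.card ≤ Nat.card G := by
    exact_mod_cast h.card_le_of_commGroup
  have h₂ := Real.log_le_log (by positivity) h₁
  linarith

/-- If `G` realizes `⟨n, m, p⟩` and has character degrees `d i`, then
`(n m p) ^ (ω / 3) ≤ ∑ (d i) ^ ω`, up to an arbitrarily small change of the exponents. -/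
theorem TripleProductProperty.rpow_le_sum_pow [DecidableEq G] {S T U : Finset G}
    (h : TripleProductProperty S T U) (hQ : 2 ≤ S.card * T.card * U.card)
    {s : ℕ} {d : Fin s → ℕ} (hd : ∀ i, d i ≠ 0) {a b c : ∀ i, G → Fin (d i) × Fin (d i) → ℂ}
    (habc : ∀ g h k, groupTensor G g h k =
        ∑ i, ∑ x, ∑ y, ∑ z, a i g x * b i h y * c i k z *
          matMulTensor (Fin (d i)) (Fin (d i)) (Fin (d i)) x y z)
    {v w : ℝ} (hv2 : 2 ≤ v) (hv : v < matMulExponent) (hw : matMulExponent < w) :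
    ((S.card * T.card * U.card : ℕ) : ℝ) ^ v ≤ (∑ i, (d i : ℝ) ^ w) ^ 3 := by
  set Q := S.card * T.card * U.card with hQdef
  set D := ∑ i, (d i : ℝ) ^ w with hD
  have hD0 : 0 ≤ D := Finset.sum_nonneg fun i _ => by positivity
  -- If D³ < Q^v, a high tensor power beats the constant C³, and squaring off by `matMul_cube` gives
  -- ω ≤ v.
  by_contra! hlt
  obtain ⟨C, hC0, hC⟩ := exists_tensorRankLE_of_matMulExponent_lt hw
  have hQ0 : (0 : ℝ) < Q := by exact_mod_cast (by omega : 0 < Q)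
  have hQv : 0 < (Q : ℝ) ^ v := Real.rpow_pos_of_pos hQ0 v
  have hρ : D ^ 3 / (Q : ℝ) ^ v < 1 := (div_lt_one hQv).2 hlt
  have hρ0 : 0 ≤ D ^ 3 / (Q : ℝ) ^ v := by positivity
  obtain ⟨N, hN⟩ := exists_pow_lt_of_lt_one (show 0 < 1 / C ^ 3 by positivity) hρ
  have hN' : (D ^ 3 / (Q : ℝ) ^ v) ^ (N + 1) < 1 / C ^ 3 :=
    (pow_le_pow_of_le_one hρ0 hρ.le (Nat.le_succ N)).trans_lt hN
  have hrank := (h.tensorRankLE hd habc hC (N + 1) 1 le_rfl).matMul_cube (q := Q ^ (N + 1)) (by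
    simp only [Fintype.card_fin, hQdef]
    ring)
  rw [Nat.cast_one, Real.one_rpow, mul_one, ← hD] at hrank
  have hQN : 2 ≤ Q ^ (N + 1) := hQ.trans (Nat.le_self_pow (by omega) Q)
  refine absurd (matMulExponent_le hQN hv2 hrank ?_) (not_le.2 hv)
  rw [Nat.cast_pow, ← Real.rpow_natCast (Q : ℝ), ← Real.rpow_mul hQ0.le, mul_comm _ v,
    Real.rpow_mul hQ0.le, Real.rpow_natCast]
  rw [div_pow, div_lt_div_iff₀ (by positivity) (by positivity), one_mul] at hN'
  calc (C * D ^ (N + 1)) ^ 3 = (D ^ 3) ^ (N + 1) * C ^ 3 := by ring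
    _ < _ := hN'

/-- Bound ∑ d_i^w by d_max^(w-2) ∑ d_i² = d_max^(w-2)|G|, take logarithms at exponents ω ± ε and let
ε → 0. Since ω > 2, the lower exponent ω - ε stays above 2. -/
theorem TripleProductProperty.matMulExponent_mul_log_le [Finite G] {S T U : Finset G}
    (h : TripleProductProperty S T U) (hQ : 2 ≤ S.card * T.card * U.card)
    (hω : 2 < matMulExponent) :
    matMulExponent * Real.log (S.card * T.card * U.card) ≤
      3 * ((matMulExponent - 2) * Real.log (maxCharacterDegree G) + Real.log (Nat.card G)) := by
  classical
  obtain ⟨s, d, hd, hdeg, hsum, a, b, c, habc⟩ := exists_groupTensor_decomposition (G := G)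
  have hcard : (0 : ℝ) < Nat.card G := by exact_mod_cast Nat.card_pos
  have hdmax : ∀ i, (d i : ℝ) ≤ maxCharacterDegree G := fun i => by exact_mod_cast (hdeg i).le_max
  have hD0 : (0 : ℝ) < maxCharacterDegree G := by
    rcases Nat.eq_zero_or_pos s with rfl | hs
    · simp [eq_comm, Nat.card_pos.ne'] at hsum
    · have h0 : 0 < d ⟨0, hs⟩ := Nat.pos_of_ne_zero (hd _)
      exact lt_of_lt_of_le (by exact_mod_cast h0) (hdmax ⟨0, hs⟩)
  have hbound : ∀ w : ℝ, 2 ≤ w →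
      ∑ i, (d i : ℝ) ^ w ≤ (maxCharacterDegree G : ℝ) ^ (w - 2) * Nat.card G := by
    intro w hw
    rw [← hsum, Nat.cast_sum, Finset.mul_sum]
    refine Finset.sum_le_sum fun i _ => ?_
    have hi : (0 : ℝ) < d i := by exact_mod_cast Nat.pos_of_ne_zero (hd i)
    calc (d i : ℝ) ^ w = (d i : ℝ) ^ (w - 2) * ((d i ^ 2 : ℕ) : ℝ) := by
          rw [Nat.cast_pow, ← Real.rpow_two, ← Real.rpow_add hi, sub_add_cancel]
      _ ≤ _ := by
          refine mul_le_mul_of_nonneg_right ?_ (Nat.cast_nonneg _)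
          exact Real.rpow_le_rpow hi.le (hdmax i) (by linarith)
  have hQ0 : (0 : ℝ) < (S.card * T.card * U.card : ℕ) := by
    exact_mod_cast (by omega : 0 < S.card * T.card * U.card)
  have hQcast : ((S.card * T.card * U.card : ℕ) : ℝ) = S.card * T.card * U.card := by push_cast; rfl
  have key : ∀ ε : ℝ, 0 < ε → ε < matMulExponent - 2 →
      (matMulExponent - ε) * Real.log (S.card * T.card * U.card) ≤
      3 * ((matMulExponent + ε - 2) * Real.log (maxCharacterDegree G) +
        Real.log (Nat.card G)) := by
    intro ε hε hε'
    have h₁ := h.rpow_le_sum_pow hQ hd habc (v := matMulExponent - ε) (w := matMulExponent + ε)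
      (by linarith) (by linarith) (by linarith)
    have h₂ := h₁.trans (pow_le_pow_left₀ (Finset.sum_nonneg fun i _ => by positivity)
      (hbound (matMulExponent + ε) (by linarith)) 3)
    have h₃ := Real.log_le_log (Real.rpow_pos_of_pos hQ0 _) h₂
    rw [Real.log_rpow hQ0, Real.log_pow, Real.log_mul (Real.rpow_pos_of_pos hD0 _).ne' hcard.ne',
      Real.log_rpow hD0, hQcast] at h₃
    exact_mod_cast h₃
  have hl : Filter.Tendsto (fun ε : ℝ => (matMulExponent - ε) *
      Real.log (S.card * T.card * U.card)) (nhdsWithin 0 (Set.Ioi 0))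
      (nhds (matMulExponent * Real.log (S.card * T.card * U.card))) := by
    refine (Continuous.tendsto' (by fun_prop) _ _ (by simp)).mono_left nhdsWithin_le_nhds
  have hr : Filter.Tendsto (fun ε : ℝ => 3 * ((matMulExponent + ε - 2) *
      Real.log (maxCharacterDegree G) + Real.log (Nat.card G))) (nhdsWithin 0 (Set.Ioi 0))
      (nhds (3 * ((matMulExponent - 2) * Real.log (maxCharacterDegree G) +
        Real.log (Nat.card G)))) := by
    refine (Continuous.tendsto' (by fun_prop) _ _ (by simp)).mono_left nhdsWithin_le_nhds
  refine le_of_tendsto_of_tendsto hl hr ?_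
  filter_upwards [Ioo_mem_nhdsGT (show (0 : ℝ) < matMulExponent - 2 by linarith)] with ε hε
  exact key ε hε.1 hε.2

theorem matMulExponent_mul_log_card_le [Finite G] [Nontrivial G] (hω : 2 < matMulExponent) :
    matMulExponent * Real.log (Nat.card G) ≤ pseudoExponent G *
      ((matMulExponent - 2) * Real.log (maxCharacterDegree G) + Real.log (Nat.card G)) := by
  have hg : 0 < Real.log (Nat.card G) := Real.log_pos (by exact_mod_cast Finite.one_lt_card)
  have hl : 0 ≤ (matMulExponent - 2) * Real.log (maxCharacterDegree G) :=
    mul_nonneg (by linarith) (Real.log_natCast_nonneg _)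
  rw [pseudoExponent_eq_sInf]
  obtain ⟨_, _, _, hn, hm, hp, hne, ⟨S, T, U, rfl, rfl, rfl, h⟩, hx⟩ :=
    pseudoExponentSet_nonempty.csInf_mem (pseudoExponentSet_finite (G := G))
  have hQ := log_mul_mul_pos hn hm hp hne
  have hQ2 : 2 ≤ S.card * T.card * U.card := by
    by_contra! hlt
    have h1 : S.card * T.card * U.card = 1 := by
      have := Nat.mul_pos (Nat.mul_pos hn hm) hp
      omega
    have h2 : (S.card : ℝ) * T.card * U.card = 1 := by exact_mod_cast h1
    rw [h2, Real.log_one] at hQ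
    exact lt_irrefl _ hQ
  have hmain := h.matMulExponent_mul_log_le hQ2 hω
  rw [hx, div_mul_eq_mul_div, le_div_iff₀ hQ]
  nlinarith

end PseudoExponent

theorem mainTheorem4 {G : ℕ → Type*} [∀ i, Group (G i)] [∀ i, Finite (G i)]
    (hα : Filter.Tendsto (fun i => pseudoExponent (G i)) Filter.atTop (nhds (2 : ℝ)))
    (hγ : ∀ c : ℝ, 0 < c → ∀ᶠ i in Filter.atTop,
      ((|pseudoExponent (G i) - 2| : ℝ) : EReal) ≤ (c : EReal) * (degreeExponent (G i) - 2)) :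
    matMulExponent = 2 := by
  refine le_antisymm (not_lt.1 fun hω => ?_) two_le_matMulExponent
  set η := matMulExponent - 2 with hη
  have hη0 : 0 < η := by linarith
  -- With this c, (α-2)(η+2) ≤ (η/4)(γ-2); the bound α-2 < η/4 controls the other error term. The
  -- margin 1/2 below keeps α < 3, excluding trivial and abelian groups.
  have hc : 0 < η / (4 * (η + 2)) := by positivity
  obtain ⟨i, hi, hαi⟩ := ((hγ _ hc).and (hα.eventually
    (gt_mem_nhds (show (2 : ℝ) < 2 + min (η / 4) (1 / 2) by
      have : 0 < min (η / 4) (1 / 2) := by positivity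
      linarith)))).exists
  have hα₁ : pseudoExponent (G i) < 2 + η / 4 :=
    hαi.trans_le (by linarith [min_le_left (η / 4) (1 / 2)])
  have hα₂ : pseudoExponent (G i) < 3 :=
    hαi.trans_le (by linarith [min_le_right (η / 4) (1 / 2)])
  have hnt : Nontrivial (G i) := by
    by_contra hnt
    rw [pseudoExponent, if_neg hnt] at hα₂
    exact lt_irrefl _ hα₂
  have hnc : ¬ ∀ a b : G i, a * b = b * a := by
    intro hcomm
    let _ : CommGroup (G i) := { (inferInstance : Group (G i)) with mul_comm := hcomm }
    exact absurd (three_le_pseudoExponent (G := G i)) (not_le.2 hα₂)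
  have h2 := two_lt_pseudoExponent (G := G i)
  have hmain := matMulExponent_mul_log_card_le (G := G i) hω
  have hg : 0 < Real.log (Nat.card (G i)) := Real.log_pos (by exact_mod_cast Finite.one_lt_card)
  rw [degreeExponent, if_neg hnc] at hi
  have hi' : |pseudoExponent (G i) - 2| ≤ η / (4 * (η + 2)) *
      (Real.log (Nat.card (G i)) / Real.log (maxCharacterDegree (G i)) - 2) := by
    rw [← EReal.coe_le_coe_iff, EReal.coe_mul, EReal.coe_sub]
    exact hi
  rw [abs_of_pos (by linarith)] at hi'
  -- The strict inequality α > 2 forces γ > 2. This in turn excludes log d_max = 0, where the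
  -- quotient would default to 0.
  have hγ2 : 0 < Real.log (Nat.card (G i)) / Real.log (maxCharacterDegree (G i)) - 2 :=
    pos_of_mul_pos_right (lt_of_lt_of_le (by linarith) hi') hc.le
  have hl : 0 < Real.log (maxCharacterDegree (G i)) := by
    refine lt_of_le_of_ne (Real.log_natCast_nonneg _) fun h0 => ?_
    rw [← h0, div_zero] at hγ2
    linarith
  set h := Real.log (Nat.card (G i)) / Real.log (maxCharacterDegree (G i)) - 2 with hh
  have hgl : Real.log (Nat.card (G i)) = (h + 2) * Real.log (maxCharacterDegree (G i)) := by
    rw [hh, sub_add_cancel, div_mul_cancel₀ _ hl.ne']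
  set α := pseudoExponent (G i) with hαdef
  rw [hgl] at hmain
  have hmain' : (η + 2) * (h + 2) ≤ α * (η + (h + 2)) := by
    refine le_of_mul_le_mul_right ?_ hl
    linear_combination hmain
  -- Here η = ω-2 and h = γ-2; both terms on the right are at most ηh/4, contradicting ηh > 0.
  have h₁ : η * h ≤ (α - 2) * (η + 2) + (α - 2) * h := by linear_combination hmain'
  have h₂ : (α - 2) * (η + 2) ≤ η / 4 * h := by
    calc (α - 2) * (η + 2) ≤ η / (4 * (η + 2)) * h * (η + 2) := by gcongr
      _ = η / 4 * h := by field_simp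
  have h₃ : (α - 2) * h ≤ η / 4 * h := by
    gcongr
    linarith
  nlinarith
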